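/- Let $\phi$ be a rotationally symmetric probability density on $\mathbb{R}^2$ that vanishes for $|x|\ge 1$, let $\nu\in(1/2,1)$, and let $(\xi_{j,k})_{(j,k)\in\mathbb{Z}^2}$ be independent random points of $\mathbb{R}^2$, each with density $\phi$. For $\epsilon>0$ set $$\mathcal{Y}_{\epsilon}=\{(j,k)+\epsilon^{1-\nu}\xi_{j,k} : (j,k)\in\mathbb{Z}^2\},\qquad \mathcal{Y}_{\epsilon,\epsilon}=\sqrt{\epsilon}\,\mathcal{Y}_{\epsilon}.$$ Place a circular obstacle of radius $\epsilon$ at each point of $\mathcal{Y}_{\epsilon,\epsilon}$, and let $T^t_{\mathcal{Y}_{\epsilon,\epsilon}}(x,v)\in\mathbb{R}^2\times S^1$ be the state at time $t$ of a point particle that starts at $(x,v)\in\mathbb{R}^2\times S^1$, moves with constant velocity between collisions, and is specularly reflected whenever it hits an obstacle from the outside; a particle may start inside an obstacle, and crosses the obstacle boundary from the inside without change of velocity. For two particles among the same obstacles (and without mutual interaction) write $T^t_{\mathcal{Y}_{\epsilon,\epsilon}}(x,v,x',v')=\big(T^t_{\mathcal{Y}_{\epsilon,\epsilon}}(x,v),T^t_{\mathcal{Y}_{\epsilon,\epsilon}}(x',v')\big)$,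 and let $(g_1\otimes g_2)(z,z')=g_1(z)g_2(z')$. Let $\bar t>0$, let $f_0$ be a probability density on $\mathbb{R}^2\times S^1$ (with respect to $dx\,dv$, Lebesgue measure times arc length), and let $g_1,g_2:\mathbb{R}^2\times S^1\to\mathbb{R}$ be continuous functions supported in $B_M\times S^1$, where $B_M$ is the ball of radius $M>0$ centred at the origin. Then for every $t\in[0,\bar t]$ $$\lim_{\epsilon\to 0^+}\int_{(\mathbb{R}^2\times S^1)^2} f_0(x,v)f_0(x',v')\Big(\mathbb{E}\big[(g_1\otimes g_2)(T^t_{\mathcal{Y}_{\epsilon,\epsilon}}(x,v,x',v'))\big]-\mathbb{E}\big[g_1(T^t_{\mathcal{Y}_{\epsilon,\epsilon}}(x,v))\big]\,\mathbb{E}\big[g_2(T^t_{\mathcal{Y}_{\epsilon,\epsilon}}(x',v'))\big]\Big)\,dx\,dv\,dx'\,dv'=0 .$$ Here, for all sufficiently small $\epsilon>0$, the expectations and the integral are well defined: $T^t_{\mathcal{Y}_{\epsilon,\epsilon}}(x,v)$ is, up to null sets, measurable in the random configuration for every $(x,v)$, and jointly measurable in the random configuration and $(x,v)$. -/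

import Mathlib

open MeasureTheory ProbabilityTheory Filter Topology
open scoped RealInnerProductSpace

noncomputable section

namespace LorentzGas

/-- The Euclidean plane. -/
abbrev Plane : Type := EuclideanSpace ℝ (Fin 2)

/-- The unit circle of velocities. -/
abbrev UnitCircle : Type := Metric.sphere (0 : Plane) 1

/-- The one-particle phase space: positions and unit velocities. -/
abbrev Phase : Type := Plane × UnitCircle

/-- The measure `dx dv`: Lebesgue measure times arc length. -/
def phaseVolume : Measure Phase :=
  (volume : Measure Plane).prod (volume : Measure Plane).toSphere

/-- Motion with constant velocity during a time `s`. -/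
def freeFlight (s : ℝ) (z : Phase) : Phase :=
  (z.1 + s • (z.2 : Plane), z.2)

/-- The particle sits on the boundary of the disk of centre `c` and radius `r` and its velocity
points into the disk. A particle leaving a disk from its inside, or touching it tangentially, is
not in this situation, and its velocity does not change. -/
def IsHit (r : ℝ) (c : Plane) (z : Phase) : Prop :=
  ‖z.1 - c‖ = r ∧ ⟪z.1 - c, (z.2 : Plane)⟫ < 0

/-- The times at which the straight path from `z` enters one of the disks of radius `r` centred
at the points of `S`. -/
def hitTimes (S : Set Plane) (r : ℝ) (z : Phase) : Set ℝ :=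
  {s | 0 ≤ s ∧ ∃ c ∈ S, IsHit r c (freeFlight s z)}

/-- Specular reflection of the velocity at a circle centred at `c` through the position: the
velocity is reflected in the tangent line, the orthogonal complement of the normal `z.1 - c`. -/
def reflectAt (c : Plane) (z : Phase) : Phase :=
  (z.1, ⟨(Submodule.span ℝ {z.1 - c})ᗮ.reflection (z.2 : Plane), by simp⟩)

open Classical in
/-- The state just after a collision. The centre `c` is unique if the disks are disjoint. -/
def collide (S : Set Plane) (r : ℝ) (z : Phase) : Phase :=
  if h : ∃ c ∈ S, IsHit r c z then reflectAt h.choose z else z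

open Classical in
/-- The state at time `t` of a particle started at `z` for which the first `n` collisions are
carried out, all later ones being ignored. -/
def flowUpTo (S : Set Plane) (r : ℝ) : ℕ → ℝ → Phase → Phase
  | 0, t, z => freeFlight t z
  | n + 1, t, z =>
    if (hitTimes S r z).Nonempty ∧ sInf (hitTimes S r z) ≤ t then
      flowUpTo S r n (t - sInf (hitTimes S r z))
        (collide S r (freeFlight (sInf (hitTimes S r z)) z))
    else freeFlight t z

open Classical in
/-- The Lorentz flow with obstacles of radius `r` centred at the points of `S`. If there are `M`
collisions up to time `t`, then `flowUpTo S r n t z` is the same for all `n ≥ M`, and this is the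
state at time `t`. (If there were infinitely many collisions, which cannot happen for disks at
mutual distances bounded away from zero, the value would be the dummy `z`.) -/
def lorentzFlow (S : Set Plane) (r : ℝ) (t : ℝ) (z : Phase) : Phase :=
  if h : ∃ w, ∀ᶠ n in atTop, flowUpTo S r n t z = w then h.choose else z

/-- Two particles that move among the same obstacles and do not interact with each other. -/
def lorentzPairFlow (S : Set Plane) (r : ℝ) (t : ℝ) (p : Phase × Phase) : Phase × Phase :=
  (lorentzFlow S r t p.1, lorentzFlow S r t p.2)

/-- The point `(j, k)` of the integer lattice. -/
def latticePoint (j : ℤ × ℤ) : Plane := !₂[(j.1 : ℝ), (j.2 : ℝ)]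

/-- The perturbed lattice: the points `(j, k) + ε ^ (1 - ν) x_{j,k}` (microscopic scale). -/
def perturbedLattice (ν ε : ℝ) (x : ℤ × ℤ → Plane) : Set Plane :=
  Set.range fun j => latticePoint j + ε ^ (1 - ν) • x j

/-- The perturbed lattice in the macroscopic scale. -/
def obstacleCenters (ν ε : ℝ) (x : ℤ × ℤ → Plane) : Set Plane :=
  (fun y => √ε • y) '' perturbedLattice ν ε x

/-- A probability density with respect to the measure `m`. -/
structure IsProbDensity {α : Type*} [MeasurableSpace α] (m : Measure α) (f : α → ℝ) : Prop where
  nonneg : ∀ a, 0 ≤ f a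
  integrable : Integrable f m
  integral_eq_one : ∫ a, f a ∂m = 1

/-- The random variables `ξ_{j,k}` are independent, each with density `φ`. -/
structure IsIIDWithDensity {Ω : Type*} [MeasurableSpace Ω] (P : Measure Ω) (φ : Plane → ℝ)
    (ξ : ℤ × ℤ → Ω → Plane) : Prop where
  measurable : ∀ j, Measurable (ξ j)
  indep : iIndepFun ξ P
  law : ∀ j, P.map (ξ j) = (volume : Measure Plane).withDensity fun x => ENNReal.ofReal (φ x)

/-- The Lorentz process: the Lorentz flow among the random obstacles of radius `ε` centred at the
points of the rescaled perturbed lattice. -/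
def lorentzProcess {Ω : Type*} (ν : ℝ) (ξ : ℤ × ℤ → Ω → Plane) (ε t : ℝ) (ω : Ω) (z : Phase) :
    Phase :=
  lorentzFlow (obstacleCenters ν ε fun j => ξ j ω) ε t z

/-- Two particles evolving with the Lorentz process, among the same random obstacles. -/
def lorentzPairProcess {Ω : Type*} (ν : ℝ) (ξ : ℤ × ℤ → Ω → Plane) (ε t : ℝ) (ω : Ω)
    (p : Phase × Phase) : Phase × Phase :=
  lorentzPairFlow (obstacleCenters ν ε fun j => ξ j ω) ε t p

/-- The tensor product of two functions on the one-particle phase space. -/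
def tensor (g₁ g₂ : Phase → ℝ) (p : Phase × Phase) : ℝ := g₁ p.1 * g₂ p.2

end LorentzGas

end

/-!
The covariance of the two particles is small because, in two independent copies of the obstacle
configuration, their trajectories rarely come close to the same lattice point. The argument rests on
the independence of the perturbations, on the bound `‖ξ‖ < 1`, and on the fact that the flow almost
preserves volume.

*Decoupling.* Let `L = √ε` be the lattice spacing and `δ = L ε ^ (1 - ν) + ε`. Up to time `t` a
trajectory depends only on the perturbations at the lattice sites to which it comes closer than `δ`
(`SmallScale.latticeFlow_congr`), and a finite set `A` of sites that contains these is a stopping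
set: the coordinates off `A` can be replaced by those of an independent copy
(`ResamplingInvariant.map_glue`). Hence the covariance is at most a constant times the probability
that the sites revealed by the first particle in one configuration meet the sites visited by the
second particle in an independent configuration (`ResamplingInvariant.enorm_covariance_le`).

*Counting.* A trajectory of length `t` comes close to at most `O(1 / L)` lattice points
(`SmallScale.tsum_measure_mem_visited_le`). On the other hand the set of initial states from which
a given disk of radius about `δ` is visited has volume `O(δ)`: watch the trajectory at the multiples
of `δ` and use that the flow at most doubles volumes (`Separated.measure_preimage_le`). For an
initial density bounded by `K` the union bound gives `O(K δ / L)`, which tends to `0` since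
`δ / L = ε ^ (1 - ν) + √ε`. A general initial density is truncated
(`lintegral_meetingProb_le`).

*Volumes.* In a time shorter than the gap between the obstacles a particle collides at most once. In
the coordinates along and across the velocity, relative to the centre of the disk, a collision is a
skew product: it conserves the impact parameter `b`, rotates the velocity by an angle that depends
on `b` alone and shifts the other coordinate by an amount that depends on `b` alone. So it preserves
volume (`measurePreserving_scatter`), no Jacobian being needed. Outside the obstacles the short time
flow is injective (`Separated.injOn_lorentzFlow`), so it does not increase volumes, and the
semigroup property extends this to all times.
-/

open scoped ENNReal

namespace LorentzGas

/-! ### Collisions with disks -/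

section

/-- The disks of radius `r` centred at the points of `S` have mutual distances at least `g`. -/
structure Separated (S : Set Plane) (r g : ℝ) : Prop where
  radius_pos : 0 < r
  gap_pos : 0 < g
  le_dist : ∀ c ∈ S, ∀ c' ∈ S, c ≠ c' → 2 * r + g ≤ dist c c'

lemma norm_velocity (z : Phase) : ‖(z.2 : Plane)‖ = 1 := by simp

lemma inner_velocity_self (z : Phase) : ⟪(z.2 : Plane), (z.2 : Plane)⟫ = 1 := by
  rw [real_inner_self_eq_norm_sq, norm_velocity]; norm_num

@[simp] lemma freeFlight_zero (z : Phase) : freeFlight 0 z = z := by simp [freeFlight]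

lemma freeFlight_add (s u : ℝ) (z : Phase) :
    freeFlight (s + u) z = freeFlight u (freeFlight s z) := by
  simp only [freeFlight, add_smul, add_assoc]

@[simp] lemma freeFlight_snd (s : ℝ) (z : Phase) : (freeFlight s z).2 = z.2 := rfl

lemma freeFlight_fst_sub (s : ℝ) (z : Phase) (c : Plane) :
    (freeFlight s z).1 - c = (z.1 - c) + s • (z.2 : Plane) := by
  simp only [freeFlight]; abel

lemma dist_freeFlight (s u : ℝ) (z : Phase) :
    dist (freeFlight s z).1 (freeFlight u z).1 = |s - u| := by
  rw [dist_eq_norm]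
  simp only [freeFlight]
  rw [add_sub_add_left_eq_sub, ← sub_smul, norm_smul, norm_velocity, mul_one, Real.norm_eq_abs]

/-- The component of the position relative to `c` along the velocity. -/
noncomputable def along (c : Plane) (z : Phase) : ℝ := ⟪z.1 - c, (z.2 : Plane)⟫

/-- `r ^ 2 - b ^ 2`, where `b` is the impact parameter of `z` with respect to `c`: the square of
half the length of the chord that the line through `z` cuts out of the disk, if positive. -/
noncomputable def chordSq (r : ℝ) (c : Plane) (z : Phase) : ℝ :=
  r ^ 2 - ‖z.1 - c‖ ^ 2 + along c z ^ 2

/-- The (possibly negative) time at which the line through `z` enters the disk. -/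
noncomputable def entryTime (r : ℝ) (c : Plane) (z : Phase) : ℝ :=
  -along c z - √(chordSq r c z)

lemma along_freeFlight (c : Plane) (s : ℝ) (z : Phase) :
    along c (freeFlight s z) = along c z + s := by
  rw [along, freeFlight_fst_sub, freeFlight_snd, inner_add_left, real_inner_smul_left,
    inner_velocity_self, mul_one, along]

lemma norm_freeFlight_sub_sq (c : Plane) (s : ℝ) (z : Phase) :
    ‖(freeFlight s z).1 - c‖ ^ 2 = ‖z.1 - c‖ ^ 2 + 2 * s * along c z + s ^ 2 := by
  rw [freeFlight_fst_sub, norm_add_sq_real, norm_smul, norm_velocity, real_inner_smul_right, along,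
    Real.norm_eq_abs, mul_one, sq_abs]
  ring

lemma chordSq_freeFlight (r : ℝ) (c : Plane) (s : ℝ) (z : Phase) :
    chordSq r c (freeFlight s z) = chordSq r c z := by
  rw [chordSq, chordSq, norm_freeFlight_sub_sq, along_freeFlight]; ring

/-- The path enters the disk only at `entryTime`, and only if its chord is not degenerate. -/
lemma isHit_freeFlight_iff {r : ℝ} (hr : 0 < r) (c : Plane) (s : ℝ) (z : Phase) :
    IsHit r c (freeFlight s z) ↔ 0 < chordSq r c z ∧ s = entryTime r c z := by
  have h1 : IsHit r c (freeFlight s z) ↔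
      (along c z + s) ^ 2 = chordSq r c z ∧ along c z + s < 0 := by
    rw [IsHit, ← along_freeFlight]
    change _ ∧ along c (freeFlight s z) < 0 ↔ _
    rw [← sq_eq_sq₀ (norm_nonneg _) hr.le, norm_freeFlight_sub_sq, chordSq, along_freeFlight]
    constructor
    · rintro ⟨h, h'⟩; exact ⟨by linarith, h'⟩
    · rintro ⟨h, h'⟩; exact ⟨by linarith, h'⟩
  rw [h1, entryTime]
  constructor
  · rintro ⟨h, h'⟩
    have : √(chordSq r c z) = -(along c z + s) := by
      rw [← h, Real.sqrt_sq_eq_abs, abs_of_neg h']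
    refine ⟨by rw [← h]; nlinarith, by linarith⟩
  · rintro ⟨h, h'⟩
    have := Real.sq_sqrt h.le
    have := Real.sqrt_pos.2 h
    subst h'
    exact ⟨by ring_nf; linarith, by linarith⟩

lemma reflection_velocity (c : Plane) (z : Phase) :
    ((reflectAt c z).2 : Plane) =
      (z.2 : Plane) - (2 * (along c z / ‖z.1 - c‖ ^ 2)) • (z.1 - c) := by
  simp only [reflectAt]
  rw [Submodule.reflection_orthogonal_apply, Submodule.reflection_singleton_apply, along]
  simp only [RCLike.ofReal_real_eq_id, id_eq, ← Nat.cast_smul_eq_nsmul ℝ, smul_smul]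
  push_cast
  abel

lemma along_reflectAt (c : Plane) (z : Phase) : along c (reflectAt c z) = -along c z := by
  have h := reflection_velocity c z
  change ⟪z.1 - c, ((reflectAt c z).2 : Plane)⟫ = _
  rw [h, inner_sub_right, real_inner_smul_right, real_inner_self_eq_norm_sq]
  change along c z - _ = _
  rcases eq_or_ne (z.1 - c) 0 with h0 | h0
  · simp [along, h0]
  · have : ‖z.1 - c‖ ≠ 0 := norm_ne_zero_iff.2 h0
    field_simp; ring

/-- After a collision the particle moves away from the disk and does not hit it again. -/
lemma not_isHit_of_along_nonneg {r : ℝ} {c : Plane} {z : Phase} (h : 0 ≤ along c z) {s : ℝ}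
    (hs : 0 ≤ s) : ¬ IsHit r c (freeFlight s z) := by
  rintro ⟨-, h'⟩
  change along c (freeFlight s z) < 0 at h'
  rw [along_freeFlight] at h'
  linarith

lemma along_reflectAt_pos {r : ℝ} {c : Plane} {z : Phase} (h : IsHit r c z) :
    0 < along c (reflectAt c z) := by
  rw [along_reflectAt]
  exact neg_pos.2 h.2

variable {S : Set Plane} {r g : ℝ}

namespace Separated

/-- Collisions at nearby places are with the same disk. -/
lemma eq_of_isHit (hS : Separated S r g) {c c' : Plane} (hc : c ∈ S) (hc' : c' ∈ S)
    {z z' : Phase} (h : IsHit r c z) (h' : IsHit r c' z') (hz : dist z.1 z'.1 < g) : c = c' := by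
  by_contra hne
  have := hS.le_dist c hc c' hc' hne
  have h1 := dist_triangle4 c z.1 z'.1 c'
  rw [dist_comm c z.1, dist_eq_norm z.1 c, dist_eq_norm z'.1 c', h.1, h'.1] at h1
  linarith

lemma collide_eq (hS : Separated S r g) {c : Plane} (hc : c ∈ S) {z : Phase}
    (h : IsHit r c z) : collide S r z = reflectAt c z := by
  have hex : ∃ c ∈ S, IsHit r c z := ⟨c, hc, h⟩
  rw [collide, dif_pos hex, hS.eq_of_isHit hex.choose_spec.1 hc hex.choose_spec.2 h
    (by simpa using hS.gap_pos)]

lemma le_abs_sub (hS : Separated S r g) {z : Phase} {s u : ℝ} (hs : s ∈ hitTimes S r z)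
    (hu : u ∈ hitTimes S r z) (hne : s ≠ u) : g ≤ |s - u| := by
  obtain ⟨-, c, hc, h⟩ := hs
  obtain ⟨-, c', hc', h'⟩ := hu
  by_contra! hlt
  obtain rfl := hS.eq_of_isHit hc hc' h h' (by rwa [dist_freeFlight])
  rw [isHit_freeFlight_iff hS.radius_pos] at h h'
  exact hne (h.2.trans h'.2.symm)

lemma isLeast_sInf (hS : Separated S r g) {z : Phase} (hne : (hitTimes S r z).Nonempty) :
    IsLeast (hitTimes S r z) (sInf (hitTimes S r z)) := by
  have hb : BddBelow (hitTimes S r z) := ⟨0, fun s hs => hs.1⟩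
  obtain ⟨s, hs, hlt⟩ := exists_lt_of_csInf_lt hne (lt_add_of_pos_right _ hS.gap_pos)
  have hl : IsLeast (hitTimes S r z) s := by
    refine ⟨hs, fun u hu => ?_⟩
    by_contra! hus
    have h1 := hS.le_abs_sub hs hu hus.ne'
    rw [abs_of_pos (by linarith)] at h1
    have := csInf_le hb hu
    linarith
  rwa [hl.csInf_eq]

/-- The hit times after a collision are at least the gap between the disks. -/
lemma le_of_mem_hitTimes_reflectAt (hS : Separated S r g) {c : Plane} (hc : c ∈ S) {z : Phase}
    (h : IsHit r c z) {s : ℝ} (hs : s ∈ hitTimes S r (reflectAt c z)) : g ≤ s := by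
  obtain ⟨hs0, c', hc', h'⟩ := hs
  by_contra! hlt
  have hd := dist_freeFlight 0 s (reflectAt c z)
  rw [freeFlight_zero, zero_sub, abs_neg, abs_of_nonneg hs0] at hd
  obtain rfl := hS.eq_of_isHit hc hc' h h' (hd.trans_lt hlt)
  exact not_isHit_of_along_nonneg (along_reflectAt_pos h).le hs0 h'

end Separated

/-! ### The Lorentz flow among separated disks -/

lemma flowUpTo_of_forall_lt {z : Phase} {t : ℝ} (h : ∀ s ∈ hitTimes S r z, t < s) (n : ℕ)
    (hS : Separated S r g) : flowUpTo S r n t z = freeFlight t z := by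
  cases n with
  | zero => rfl
  | succ n =>
    rw [flowUpTo, if_neg]
    rintro ⟨hne, hle⟩
    exact (h _ (hS.isLeast_sInf hne).1).not_ge hle

lemma flowUpTo_succ_of_isLeast {z : Phase} {t τ : ℝ} (h : IsLeast (hitTimes S r z) τ)
    (hτ : τ ≤ t) (n : ℕ) :
    flowUpTo S r (n + 1) t z = flowUpTo S r n (t - τ) (collide S r (freeFlight τ z)) := by
  rw [flowUpTo, h.csInf_eq, if_pos ⟨h.nonempty, hτ⟩]

namespace Separated

lemma le_of_mem_hitTimes_collide (hS : Separated S r g) {z : Phase} {τ : ℝ}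
    (h : τ ∈ hitTimes S r z) {s : ℝ}
    (hs : s ∈ hitTimes S r (collide S r (freeFlight τ z))) : g ≤ s := by
  obtain ⟨-, c, hc, hh⟩ := h
  rw [hS.collide_eq hc hh] at hs
  exact hS.le_of_mem_hitTimes_reflectAt hc hh hs

lemma forall_lt_or_isLeast (hS : Separated S r g) (t : ℝ) (z : Phase) :
    (∀ s ∈ hitTimes S r z, t < s) ∨ ∃ τ ≤ t, IsLeast (hitTimes S r z) τ := by
  by_cases h : ∃ s ∈ hitTimes S r z, s ≤ t
  · obtain ⟨s, hs, hst⟩ := h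
    have := hS.isLeast_sInf ⟨s, hs⟩
    exact Or.inr ⟨_, (this.2 hs).trans hst, this⟩
  · push Not at h
    exact Or.inl h

/-- Induction along a trajectory: over the collisions up to time `t`. -/
theorem flow_induction (hS : Separated S r g) {Q : ℝ → Phase → Prop}
    (free : ∀ t z, 0 ≤ t → (∀ s ∈ hitTimes S r z, t < s) → Q t z)
    (hit : ∀ t z τ, IsLeast (hitTimes S r z) τ → τ ≤ t →
      Q (t - τ) (collide S r (freeFlight τ z)) → Q t z) (t : ℝ) (z : Phase) (ht : 0 ≤ t) :
    Q t z := by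
  have key : ∀ n : ℕ, ∀ t z, 0 ≤ t → t < n * g → (∀ s ∈ hitTimes S r z, g ≤ s) → Q t z := by
    intro n
    induction n with
    | zero => intro t z ht ht'; simp at ht'; linarith
    | succ n ih =>
      intro t z ht ht' hz
      rcases hS.forall_lt_or_isLeast t z with h | ⟨τ, hτ, hl⟩
      · exact free t z ht h
      · refine hit t z τ hl hτ (ih _ _ (by linarith) ?_ fun s hs => ?_)
        · have := hz _ hl.1
          push_cast at ht'
          linarith
        · exact hS.le_of_mem_hitTimes_collide hl.1 hs
  rcases hS.forall_lt_or_isLeast t z with h | ⟨τ, hτ, hl⟩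
  · exact free t z ht h
  · obtain ⟨n, hn⟩ := exists_nat_gt ((t - τ) / g)
    exact hit t z τ hl hτ (key n _ _ (by linarith) (by rwa [div_lt_iff₀ hS.gap_pos] at hn)
      fun s hs => hS.le_of_mem_hitTimes_collide hl.1 hs)

lemma exists_eventually_flowUpTo_eq (hS : Separated S r g) (t : ℝ) (z : Phase) :
    ∃ w, ∀ᶠ n in atTop, flowUpTo S r n t z = w := by
  rcases lt_or_ge t 0 with ht | ht
  · exact ⟨freeFlight t z, Eventually.of_forall fun n =>
      flowUpTo_of_forall_lt (fun s hs => ht.trans_le hs.1) n hS⟩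
  · refine hS.flow_induction (Q := fun t z => ∃ w, ∀ᶠ n in atTop, flowUpTo S r n t z = w)
      (fun t z _ h => ⟨_, Eventually.of_forall fun n => flowUpTo_of_forall_lt h n hS⟩) ?_ t z ht
    rintro t z τ hl hτ ⟨w, hw⟩
    refine ⟨w, ?_⟩
    rw [← map_add_atTop_eq_nat 1, eventually_map]
    filter_upwards [hw] with n hn
    rw [flowUpTo_succ_of_isLeast hl hτ, hn]

lemma eventually_flowUpTo_eq (hS : Separated S r g) (t : ℝ) (z : Phase) :
    ∀ᶠ n in atTop, flowUpTo S r n t z = lorentzFlow S r t z := by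
  have h := hS.exists_eventually_flowUpTo_eq t z
  rw [lorentzFlow, dif_pos h]
  exact h.choose_spec

lemma lorentzFlow_eq_of_eventually (hS : Separated S r g) {t : ℝ} {z w : Phase}
    (h : ∀ᶠ n in atTop, flowUpTo S r n t z = w) : lorentzFlow S r t z = w := by
  obtain ⟨n, h1, h2⟩ := (h.and (hS.eventually_flowUpTo_eq t z)).exists
  exact h2.symm.trans h1

lemma lorentzFlow_of_forall_lt (hS : Separated S r g) {t : ℝ} {z : Phase}
    (h : ∀ s ∈ hitTimes S r z, t < s) : lorentzFlow S r t z = freeFlight t z :=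
  hS.lorentzFlow_eq_of_eventually <| Eventually.of_forall fun n => flowUpTo_of_forall_lt h n hS

lemma lorentzFlow_of_isLeast (hS : Separated S r g) {t τ : ℝ} {z : Phase}
    (h : IsLeast (hitTimes S r z) τ) (hτ : τ ≤ t) :
    lorentzFlow S r t z = lorentzFlow S r (t - τ) (collide S r (freeFlight τ z)) := by
  refine hS.lorentzFlow_eq_of_eventually ?_
  rw [← map_add_atTop_eq_nat 1, eventually_map]
  filter_upwards [hS.eventually_flowUpTo_eq (t - τ) (collide S r (freeFlight τ z))] with n hn
  rw [flowUpTo_succ_of_isLeast h hτ, hn]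

lemma mem_hitTimes_freeFlight {z : Phase} {s u : ℝ} (hu : 0 ≤ u) :
    u ∈ hitTimes S r (freeFlight s z) ↔ ∃ c ∈ S, IsHit r c (freeFlight (s + u) z) := by
  simp only [hitTimes, Set.mem_ofPred_eq, hu, true_and, freeFlight_add]

lemma lorentzFlow_freeFlight (hS : Separated S r g) {s u : ℝ} {z : Phase} (hs : 0 ≤ s)
    (h : ∀ σ ∈ hitTimes S r z, s < σ) :
    lorentzFlow S r (s + u) z = lorentzFlow S r u (freeFlight s z) := by
  rcases hS.forall_lt_or_isLeast (s + u) z with h' | ⟨τ, hτ, hl⟩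
  · rw [hS.lorentzFlow_of_forall_lt h', hS.lorentzFlow_of_forall_lt, freeFlight_add]
    intro σ hσ
    have := h' (s + σ) ⟨add_nonneg hs hσ.1, (mem_hitTimes_freeFlight hσ.1).1 hσ⟩
    linarith
  · have hsτ := h τ hl.1
    have hl' : IsLeast (hitTimes S r (freeFlight s z)) (τ - s) := by
      refine ⟨(mem_hitTimes_freeFlight (by linarith)).2 ?_, fun σ hσ => ?_⟩
      · rw [add_sub_cancel]; exact hl.1.2
      · have := hl.2 (show s + σ ∈ _ from
          ⟨add_nonneg hs hσ.1, (mem_hitTimes_freeFlight hσ.1).1 hσ⟩)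
        linarith
    rw [hS.lorentzFlow_of_isLeast hl hτ, hS.lorentzFlow_of_isLeast hl' (by linarith),
      ← freeFlight_add, add_sub_cancel]
    congr 1; ring

/-- The semigroup property. -/
theorem lorentzFlow_add (hS : Separated S r g) {s u : ℝ} (hs : 0 ≤ s) (hu : 0 ≤ u) (z : Phase) :
    lorentzFlow S r (s + u) z = lorentzFlow S r u (lorentzFlow S r s z) := by
  refine hS.flow_induction (Q := fun s z =>
    lorentzFlow S r (s + u) z = lorentzFlow S r u (lorentzFlow S r s z)) ?_ ?_ s z hs
  · intro s z hs h
    rw [hS.lorentzFlow_freeFlight hs h, hS.lorentzFlow_of_forall_lt h]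
  · intro s z τ hl hτ ih
    rw [hS.lorentzFlow_of_isLeast hl hτ, ← ih, hS.lorentzFlow_of_isLeast hl (by linarith)]
    congr 1; ring

lemma collide_fst (z : Phase) : (collide S r z).1 = z.1 := by
  rw [collide]; split_ifs <;> rfl

lemma dist_lorentzFlow_self_le (hS : Separated S r g) {t : ℝ} (ht : 0 ≤ t) (z : Phase) :
    dist (lorentzFlow S r t z).1 z.1 ≤ t := by
  refine hS.flow_induction (Q := fun t z => dist (lorentzFlow S r t z).1 z.1 ≤ t) ?_ ?_ t z ht
  · intro t z ht h
    rw [hS.lorentzFlow_of_forall_lt h]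
    have := dist_freeFlight t 0 z
    rw [freeFlight_zero, sub_zero, abs_of_nonneg ht] at this
    exact this.le
  · intro t z τ hl hτ ih
    rw [hS.lorentzFlow_of_isLeast hl hτ]
    refine (dist_triangle _ (collide S r (freeFlight τ z)).1 _).trans ?_
    have := dist_freeFlight τ 0 z
    rw [freeFlight_zero, sub_zero, abs_of_nonneg hl.1.1] at this
    rw [collide_fst, this]
    rw [collide_fst] at ih
    linarith

lemma dist_lorentzFlow_le (hS : Separated S r g) {s t : ℝ} (hs : 0 ≤ s) (hst : s ≤ t)
    (z : Phase) : dist (lorentzFlow S r t z).1 (lorentzFlow S r s z).1 ≤ t - s := by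
  have h := hS.lorentzFlow_add hs (sub_nonneg.2 hst) z
  rw [add_sub_cancel] at h
  rw [h]
  exact hS.dist_lorentzFlow_self_le (sub_nonneg.2 hst) _

end Separated

/-- The flow up to time `t` is not affected by moving obstacles that, in both their positions, keep
away from the trajectory. -/
lemma lorentzFlow_congr {ι : Type*} {c c' : ι → Plane} (hS : Separated (Set.range c) r g)
    (hS' : Separated (Set.range c') r g) {t : ℝ} (ht : 0 ≤ t) (z : Phase)
    (h : ∀ j, c j ≠ c' j → ∀ s ∈ Set.Icc 0 t,
      r < ‖(lorentzFlow (Set.range c) r s z).1 - c j‖ ∧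
        r < ‖(lorentzFlow (Set.range c) r s z).1 - c' j‖) :
    lorentzFlow (Set.range c') r t z = lorentzFlow (Set.range c) r t z := by
  refine hS.flow_induction (Q := fun t z => (∀ j, c j ≠ c' j → ∀ s ∈ Set.Icc 0 t,
      r < ‖(lorentzFlow (Set.range c) r s z).1 - c j‖ ∧
        r < ‖(lorentzFlow (Set.range c) r s z).1 - c' j‖) →
    lorentzFlow (Set.range c') r t z = lorentzFlow (Set.range c) r t z) ?_ ?_ t z ht h
  · intro t z ht hz h
    rw [hS.lorentzFlow_of_forall_lt hz, hS'.lorentzFlow_of_forall_lt]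
    rintro s ⟨hs, -, ⟨j, rfl⟩, hj⟩
    by_contra! hst
    have hf : lorentzFlow (Set.range c) r s z = freeFlight s z :=
      hS.lorentzFlow_of_forall_lt fun u hu => hst.trans_lt (hz u hu)
    by_cases hcj : c j = c' j
    · exact (hz s ⟨hs, _, ⟨j, rfl⟩, hcj ▸ hj⟩).not_ge hst
    · have := (h j hcj s ⟨hs, hst⟩).2
      rw [hf, hj.1] at this
      exact lt_irrefl _ this
  · intro t z τ hl hτ ih h
    obtain ⟨hτ0, -, ⟨j, rfl⟩, hj⟩ := hl.1
    have hfree : ∀ s < τ, lorentzFlow (Set.range c) r s z = freeFlight s z := fun s hs =>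
      hS.lorentzFlow_of_forall_lt fun u hu => hs.trans_le (hl.2 hu)
    have hpos : ∀ s, 0 ≤ s → lorentzFlow (Set.range c) r (τ + s) z =
        lorentzFlow (Set.range c) r s (collide (Set.range c) r (freeFlight τ z)) := by
      intro s hs
      rw [hS.lorentzFlow_of_isLeast hl (by linarith), add_sub_cancel_left]
    have hτpos : (lorentzFlow (Set.range c) r τ z).1 = (freeFlight τ z).1 := by
      have h0 := hpos 0 le_rfl
      rw [add_zero] at h0
      have h1 := hS.dist_lorentzFlow_self_le le_rfl (collide (Set.range c) r (freeFlight τ z))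
      rw [← h0, Separated.collide_fst] at h1
      exact dist_le_zero.1 h1
    have hcj : c j = c' j := by
      by_contra hne
      have := (h j hne τ ⟨hτ0, hτ⟩).1
      rw [hτpos, hj.1] at this
      exact lt_irrefl _ this
    have hl' : IsLeast (hitTimes (Set.range c') r z) τ := by
      refine ⟨⟨hτ0, _, ⟨j, rfl⟩, hcj ▸ hj⟩, ?_⟩
      rintro s ⟨hs0, -, ⟨i, rfl⟩, hi⟩
      by_contra! hs
      by_cases hci : c i = c' i
      · exact hs.not_ge (hl.2 ⟨hs0, _, ⟨i, rfl⟩, hci ▸ hi⟩)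
      · have := (h i hci s ⟨hs0, hs.le.trans hτ⟩).2
        rw [hfree s hs, hi.1] at this
        exact lt_irrefl _ this
    have hcol : collide (Set.range c') r (freeFlight τ z) =
        collide (Set.range c) r (freeFlight τ z) := by
      rw [hS.collide_eq ⟨j, rfl⟩ hj, hS'.collide_eq ⟨j, rfl⟩ (hcj ▸ hj), hcj]
    rw [hS.lorentzFlow_of_isLeast hl hτ, hS'.lorentzFlow_of_isLeast hl' hτ, hcol]
    refine ih fun i hi s hs => ?_
    have := h i hi (τ + s) ⟨add_nonneg hτ0 hs.1, by linarith [hs.2]⟩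
    rwa [hpos s hs.1] at this

end

/-! ### Measurability of the flow -/

section

lemma measurable_of_eqOn_cover {α β ι : Type*} [MeasurableSpace α] [MeasurableSpace β]
    [Countable ι] {f F₀ : α → β} {A : ι → Set α} {F : ι → α → β}
    (hA : ∀ i, MeasurableSet (A i)) (hF : ∀ i, Measurable (F i)) (hF₀ : Measurable F₀)
    (h : ∀ i, ∀ a ∈ A i, f a = F i a) (h₀ : ∀ a, (∀ i, a ∉ A i) → f a = F₀ a) :
    Measurable f := by
  intro B hB
  have : f ⁻¹' B = (⋃ i, A i ∩ F i ⁻¹' B) ∪ ((⋃ i, A i)ᶜ ∩ F₀ ⁻¹' B) := by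
    ext a
    simp only [Set.mem_preimage, Set.mem_union, Set.mem_iUnion, Set.mem_inter_iff,
      Set.mem_compl_iff, not_exists]
    constructor
    · intro ha
      by_cases hex : ∃ i, a ∈ A i
      · obtain ⟨i, hi⟩ := hex
        exact Or.inl ⟨i, hi, h i a hi ▸ ha⟩
      · push Not at hex
        exact Or.inr ⟨hex, h₀ a hex ▸ ha⟩
    · rintro (⟨i, hi, ha⟩ | ⟨hex, ha⟩)
      · rwa [h i a hi]
      · rwa [h₀ a hex]
  rw [this]
  exact (MeasurableSet.iUnion fun i => (hA i).inter (hF i hB)).union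
    ((MeasurableSet.iUnion hA).compl.inter (hF₀ hB))

section
variable {Y : Type*} [MeasurableSpace Y]

lemma measurable_freeFlight : Measurable fun p : ℝ × Phase => freeFlight p.1 p.2 := by
  unfold freeFlight
  fun_prop

lemma measurable_along {c : Y → Plane} {z : Y → Phase} (hc : Measurable c) (hz : Measurable z) :
    Measurable fun y => along (c y) (z y) := by
  unfold along
  fun_prop

lemma measurable_chordSq (r : ℝ) {c : Y → Plane} {z : Y → Phase} (hc : Measurable c)
    (hz : Measurable z) : Measurable fun y => chordSq r (c y) (z y) := by
  unfold chordSq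
  have := measurable_along hc hz
  fun_prop

lemma measurable_entryTime (r : ℝ) {c : Y → Plane} {z : Y → Phase} (hc : Measurable c)
    (hz : Measurable z) : Measurable fun y => entryTime r (c y) (z y) := by
  unfold entryTime
  have := measurable_along hc hz
  have := measurable_chordSq r hc hz
  fun_prop

lemma measurable_reflectAt {c : Y → Plane} {z : Y → Phase} (hc : Measurable c)
    (hz : Measurable z) : Measurable fun y => reflectAt (c y) (z y) := by
  refine Measurable.prodMk (by exact hz.fst) (Measurable.subtype_mk (f := fun y =>
    ((reflectAt (c y) (z y)).2 : Plane)) ?_)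
  simp only [reflection_velocity]
  have := measurable_along hc hz
  fun_prop

end

variable {r g : ℝ} {ι : Type*} {X : Type*}

lemma mem_hitTimes_range {c : ι → Plane} (hr : 0 < r) {z : Phase} {s : ℝ} :
    s ∈ hitTimes (Set.range c) r z ↔
      ∃ i, 0 < chordSq r (c i) z ∧ 0 ≤ entryTime r (c i) z ∧ s = entryTime r (c i) z := by
  simp only [hitTimes, Set.mem_ofPred_eq, Set.exists_range_iff, isHit_freeFlight_iff hr]
  constructor
  · rintro ⟨hs, i, h, rfl⟩; exact ⟨i, h, hs, rfl⟩
  · rintro ⟨i, h, hs, rfl⟩; exact ⟨hs, i, h, rfl⟩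

variable [MeasurableSpace X] [Countable ι]

theorem measurable_flowUpTo {c : ι → X → Plane} (hc : ∀ i, Measurable (c i))
    (hS : ∀ x, Separated (Set.range fun i => c i x) r g) (n : ℕ) :
    Measurable fun p : X × ℝ × Phase =>
      flowUpTo (Set.range fun i => c i p.1) r n p.2.1 p.2.2 := by
  induction n with
  | zero => exact measurable_freeFlight.comp measurable_snd
  | succ n ih =>
    have hci : ∀ i, Measurable fun p : X × ℝ × Phase => c i p.1 := fun i =>
      (hc i).comp measurable_fst
    have hz : Measurable fun p : X × ℝ × Phase => p.2.2 := by fun_prop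
    have hD := fun i => measurable_chordSq r (hci i) hz
    have hτ := fun i => measurable_entryTime r (hci i) hz
    -- `A i` is the event that the first collision up to time `t` is with the disk `i`.
    refine measurable_of_eqOn_cover (ι := ι)
      (A := fun i => {p | (0 < chordSq r (c i p.1) p.2.2 ∧ 0 ≤ entryTime r (c i p.1) p.2.2 ∧
        entryTime r (c i p.1) p.2.2 ≤ p.2.1) ∧ ∀ k, 0 < chordSq r (c k p.1) p.2.2 →
          0 ≤ entryTime r (c k p.1) p.2.2 →
            entryTime r (c i p.1) p.2.2 ≤ entryTime r (c k p.1) p.2.2})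
      (F := fun i p => flowUpTo (Set.range fun i => c i p.1) r n
        (p.2.1 - entryTime r (c i p.1) p.2.2)
          (reflectAt (c i p.1) (freeFlight (entryTime r (c i p.1) p.2.2) p.2.2)))
      (F₀ := fun p => freeFlight p.2.1 p.2.2) ?_ ?_ (measurable_freeFlight.comp measurable_snd)
      ?_ ?_
    · intro i
      have h0 : MeasurableSet {p : X × ℝ × Phase | 0 < chordSq r (c i p.1) p.2.2 ∧
          0 ≤ entryTime r (c i p.1) p.2.2 ∧ entryTime r (c i p.1) p.2.2 ≤ p.2.1} :=
        (measurableSet_lt measurable_const (hD i)).inter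
          ((measurableSet_le measurable_const (hτ i)).inter
            (measurableSet_le (hτ i) (by fun_prop)))
      refine h0.inter (measurableSet_setOfPred.2 (Measurable.forall fun k => ?_))
      have h1 := measurableSet_lt (measurable_const (a := (0 : ℝ))) (hD k)
      have h2 := measurableSet_le (measurable_const (a := (0 : ℝ))) (hτ k)
      have h3 := measurableSet_le (hτ i) (hτ k)
      rw [measurableSet_setOfPred] at h1 h2 h3
      exact h1.imp (h2.imp h3)
    · intro i
      exact ih.comp (measurable_fst.prodMk (((by fun_prop : Measurable fun p : X × ℝ × Phase =>
        p.2.1).sub (hτ i)).prodMk (measurable_reflectAt (hci i)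
          (measurable_freeFlight.comp ((hτ i).prodMk hz)))))
    · rintro i ⟨x, t, z⟩ ⟨⟨h1, h2, h3⟩, h4⟩
      have hr := (hS x).radius_pos
      have hl : IsLeast (hitTimes (Set.range fun i => c i x) r z) (entryTime r (c i x) z) := by
        refine ⟨(mem_hitTimes_range hr).2 ⟨i, h1, h2, rfl⟩, fun s hs => ?_⟩
        obtain ⟨k, hk1, hk2, rfl⟩ := (mem_hitTimes_range hr).1 hs
        exact h4 k hk1 hk2
      change flowUpTo _ r (n + 1) t z = _
      rw [flowUpTo_succ_of_isLeast hl h3,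
        (hS x).collide_eq ⟨i, rfl⟩ ((isHit_freeFlight_iff hr _ _ _).2 ⟨h1, rfl⟩)]
    · rintro ⟨x, t, z⟩ h
      refine flowUpTo_of_forall_lt (fun s hs => ?_) _ (hS x)
      by_contra! hst
      have hr := (hS x).radius_pos
      have hl := (hS x).isLeast_sInf ⟨s, hs⟩
      obtain ⟨i, h1, h2, h3⟩ := (mem_hitTimes_range hr).1 hl.1
      refine h i ⟨⟨h1, h2, ?_⟩, fun k hk1 hk2 => ?_⟩
      · exact (h3 ▸ hl.2 hs).trans hst
      · exact h3 ▸ hl.2 ((mem_hitTimes_range hr).2 ⟨k, hk1, hk2, rfl⟩)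

theorem measurable_lorentzFlow {c : ι → X → Plane} (hc : ∀ i, Measurable (c i))
    (hS : ∀ x, Separated (Set.range fun i => c i x) r g) :
    Measurable fun p : X × ℝ × Phase =>
      lorentzFlow (Set.range fun i => c i p.1) r p.2.1 p.2.2 := by
  refine measurable_of_tendsto_metrizable (measurable_flowUpTo hc hS) ?_
  rw [tendsto_pi_nhds]
  intro p
  exact tendsto_const_nhds.congr' (((hS p.1).eventually_flowUpTo_eq p.2.1 p.2.2).mono
    fun n hn => hn.symm)

lemma measurable_lorentzFlow_state {S : Set Plane} (hS : Separated S r g) (hc : S.Countable)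
    (t : ℝ) : Measurable (lorentzFlow S r t) := by
  have := hc.to_subtype
  have h := measurable_lorentzFlow (X := Unit) (c := fun (i : S) _ => (i : Plane))
    (fun i => measurable_const) (r := r) (g := g) (fun _ => by simpa using hS)
  simp only [Subtype.range_coe_subtype, Set.ofPred_mem_eq] at h
  exact h.comp (measurable_const.prodMk (measurable_const.prodMk measurable_id) :
    Measurable fun z : Phase => ((), t, z))

end

/-! ### A volume preserving map that describes one collision -/

section

/-- Rotation by a quarter turn. -/
noncomputable def perp (v : Plane) : Plane := !₂[-v 1, v 0]

/-- The impact parameter of `z` with respect to `c`: the component of the position relative to `c`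
across the velocity. -/
noncomputable def across (c : Plane) (z : Phase) : ℝ := ⟪z.1 - c, perp (z.2 : Plane)⟫

@[simp] lemma perp_zero_apply (v : Plane) : perp v 0 = -v 1 := rfl
@[simp] lemma perp_one_apply (v : Plane) : perp v 1 = v 0 := rfl

lemma inner_eq (x y : Plane) : ⟪x, y⟫ = x 0 * y 0 + x 1 * y 1 := by
  simp [PiLp.inner_apply, Fin.sum_univ_two, mul_comm]

lemma norm_sq_eq (x : Plane) : ‖x‖ ^ 2 = x 0 ^ 2 + x 1 ^ 2 := by
  rw [← real_inner_self_eq_norm_sq, inner_eq]; ring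

lemma velocity_sq (z : Phase) : (z.2 : Plane) 0 ^ 2 + (z.2 : Plane) 1 ^ 2 = 1 := by
  rw [← norm_sq_eq, norm_velocity]; norm_num

@[fun_prop] lemma continuous_perp : Continuous perp := by
  unfold perp; fun_prop

lemma norm_sub_sq (c : Plane) (z : Phase) : ‖z.1 - c‖ ^ 2 = along c z ^ 2 + across c z ^ 2 := by
  rw [norm_sq_eq, along, across, inner_eq, inner_eq, perp_zero_apply, perp_one_apply]
  linear_combination (-(z.1 - c) 0 ^ 2 - (z.1 - c) 1 ^ 2) * velocity_sq z

lemma chordSq_eq (r : ℝ) (c : Plane) (z : Phase) : chordSq r c z = r ^ 2 - across c z ^ 2 := by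
  rw [chordSq, norm_sub_sq]; ring

lemma sub_eq_along_across (c : Plane) (z : Phase) :
    z.1 - c = along c z • (z.2 : Plane) + across c z • perp (z.2 : Plane) := by
  have h := velocity_sq z
  ext i
  rw [along, across, inner_eq, inner_eq]
  fin_cases i
  · simp only [Fin.zero_eta, PiLp.add_apply, PiLp.smul_apply, smul_eq_mul, perp_zero_apply,
      perp_one_apply]
    linear_combination (-(z.1 - c) 0) * h
  · simp only [Fin.mk_one, PiLp.add_apply, PiLp.smul_apply, smul_eq_mul, perp_zero_apply,
      perp_one_apply]
    linear_combination (-(z.1 - c) 1) * h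

/-- The linear combination `α v + β (perp v)`, a rotation of `v` if `α ^ 2 + β ^ 2 = 1`. -/
noncomputable def rotate (α β : ℝ) (h : α ^ 2 + β ^ 2 = 1) : Plane ≃ₗᵢ[ℝ] Plane :=
  LinearIsometry.toLinearIsometryEquiv
    { toFun := fun v => α • v + β • perp v
      map_add' := fun v w => by
        ext i; fin_cases i <;> simp <;> ring
      map_smul' := fun k v => by
        ext i; fin_cases i <;> simp <;> ring
      norm_map' := fun v => by
        rw [← sq_eq_sq₀ (norm_nonneg _) (norm_nonneg _)]
        simp only [LinearMap.coe_mk, AddHom.coe_mk, norm_sq_eq, PiLp.add_apply, PiLp.smul_apply,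
          smul_eq_mul, perp_zero_apply, perp_one_apply]
        linear_combination (v 0 ^ 2 + v 1 ^ 2) * h } rfl

lemma rotate_apply (α β : ℝ) (h : α ^ 2 + β ^ 2 = 1) (v : Plane) :
    rotate α β h v = α • v + β • perp v := rfl

/-- The isometry of the unit circle induced by an isometry of the plane. -/
noncomputable def circleMap (e : Plane ≃ₗᵢ[ℝ] Plane) (v : UnitCircle) : UnitCircle :=
  ⟨e v, by simp⟩

lemma measurable_circleMap (e : Plane ≃ₗᵢ[ℝ] Plane) : Measurable (circleMap e) :=
  (e.continuous.measurable.comp measurable_subtype_coe).subtype_mk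

open scoped Pointwise in
lemma measurePreserving_circleMap (e : Plane ≃ₗᵢ[ℝ] Plane) :
    MeasurePreserving (circleMap e) (volume : Measure Plane).toSphere
      (volume : Measure Plane).toSphere := by
  refine ⟨measurable_circleMap e, ?_⟩
  ext s hs
  rw [Measure.map_apply (measurable_circleMap e) hs, Measure.toSphere_apply' _ hs,
    Measure.toSphere_apply' _ (measurable_circleMap e hs)]
  congr 1
  rw [← e.measurePreserving.measure_preimage_emb e.toHomeomorph.measurableEmbedding
    (Set.Ioo (0 : ℝ) 1 • (Subtype.val '' s : Set Plane))]
  congr 1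
  ext y
  simp only [Set.mem_smul, Set.mem_image, Set.mem_preimage]
  constructor
  · rintro ⟨a, ha, -, ⟨w, hw, rfl⟩, rfl⟩
    exact ⟨a, ha, _, ⟨circleMap e w, hw, rfl⟩, by simp [circleMap]⟩
  · rintro ⟨a, ha, -, ⟨w, hw, rfl⟩, h⟩
    refine ⟨a, ha, _, ⟨circleMap e.symm w, ?_, rfl⟩, ?_⟩
    · have : circleMap e (circleMap e.symm w) = w := by ext; simp [circleMap]
      rwa [this]
    · apply e.injective
      rw [← h]; simp [circleMap]

instance : SFinite phaseVolume := by 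
  unfold phaseVolume
  have : IsFiniteMeasure (volume : Measure Plane).toSphere := inferInstance
  infer_instance

/-- The position relative to `c` in the orthonormal frame given by the velocity, and the
velocity. -/
noncomputable def frame (c : Plane) (z : Phase) : Phase := (!₂[along c z, across c z], z.2)

/-- Coordinates in the orthonormal frame `v`, `perp v`. -/
noncomputable def frameIsometry (v : UnitCircle) : Plane ≃ₗᵢ[ℝ] Plane :=
  LinearIsometry.toLinearIsometryEquiv
    { toFun := fun x => !₂[⟪x, (v : Plane)⟫, ⟪x, perp (v : Plane)⟫]
      map_add' := fun v w => by
        ext i; fin_cases i <;> simp [inner_add_left]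
      map_smul' := fun k v => by
        ext i; fin_cases i <;> simp [real_inner_smul_left]
      norm_map' := fun x => by
        rw [← sq_eq_sq₀ (norm_nonneg _) (norm_nonneg _)]
        simp only [LinearMap.coe_mk, AddHom.coe_mk, norm_sq_eq]
        simp [inner_eq]
        linear_combination (x 0 ^ 2 + x 1 ^ 2) * velocity_sq (x, v) } rfl

lemma measurable_across (c : Plane) : Measurable (across c) := by
  unfold across
  exact (by fun_prop : Continuous fun z : Phase => ⟪z.1 - c, perp (z.2 : Plane)⟫).measurable

lemma measurable_frame (c : Plane) : Measurable (frame c) := by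
  have h1 : Measurable (along c) := measurable_along measurable_const measurable_id
  have h2 := measurable_across c
  unfold frame
  refine Measurable.prodMk ?_ measurable_snd
  refine (WithLp.measurable_toLp 2 (Fin 2 → ℝ)).comp (measurable_pi_iff.2 fun i => ?_)
  fin_cases i
  · exact h1
  · exact h2

lemma frame_injective (c : Plane) : Function.Injective (frame c) := by
  intro z w h
  have h2 : (frame c z).2 = (frame c w).2 := congrArg Prod.snd h
  change z.2 = w.2 at h2
  have ha : (frame c z).1 0 = (frame c w).1 0 := by rw [h]
  change along c z = along c w at ha
  have hb : (frame c z).1 1 = (frame c w).1 1 := by rw [h]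
  change across c z = across c w at hb
  refine Prod.ext ?_ h2
  have := sub_eq_along_across c z
  rw [ha, hb, h2, ← sub_eq_along_across c w] at this
  exact sub_left_injective this

lemma measurePreserving_frame (c : Plane) :
    MeasurePreserving (frame c) phaseVolume phaseVolume := by
  have h := (MeasurePreserving.id (volume : Measure Plane).toSphere).skew_product
    (μc := (volume : Measure Plane)) (μd := (volume : Measure Plane))
    (g := fun v x => (frame c (x, v)).1)
    ((measurable_frame c).fst.comp measurable_swap)
    (ae_of_all _ fun v => ((frameIsometry v).measurePreserving.comp
      (measurePreserving_sub_right volume c)).map_eq)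
  exact Measure.measurePreserving_swap.comp (h.comp Measure.measurePreserving_swap)

/-- A shear of the plane in the first coordinate direction. -/
noncomputable def shear (k : ℝ → ℝ) (y : Plane) : Plane := !₂[y 0 + k (y 1), y 1]

lemma measurePreserving_shear {k : ℝ → ℝ} (hk : Measurable k) :
    MeasurePreserving (shear k) volume volume := by
  have h1 : MeasurePreserving (fun p : ℝ × ℝ => (p.1, p.2 + k p.1)) volume volume :=
    (MeasurePreserving.id (volume : Measure ℝ)).skew_product (g := fun b a => a + k b)
      (by fun_prop) (ae_of_all _ fun b => (measurePreserving_add_right volume (k b)).map_eq)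
  have h2 : MeasurePreserving (fun p : ℝ × ℝ => (p.1 + k p.2, p.2)) volume volume :=
    Measure.measurePreserving_swap.comp (h1.comp Measure.measurePreserving_swap)
  have h3 : MeasurePreserving (fun p : ℝ × ℝ => (!₂[p.1, p.2] : Plane)) volume volume :=
    (PiLp.volume_preserving_toLp (Fin 2)).comp (volume_preserving_finTwoArrow ℝ).symm
  refine h3.of_semiconj h2 (fun p => ?_) ?_
  · simp [shear]
  · unfold shear
    refine (WithLp.measurable_toLp 2 (Fin 2 → ℝ)).comp (measurable_pi_iff.2 fun i => ?_)
    fin_cases i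
    · exact (by fun_prop : Measurable fun y : Plane => y 0 + k (y 1))
    · exact (by fun_prop : Measurable fun y : Plane => y 1)

/-- Half the length of the chord at distance `b` from the centre of a disk of radius `r` (and `0`
if the line misses the disk). -/
noncomputable def halfChord (r b : ℝ) : ℝ := √(r ^ 2 - b ^ 2)

lemma halfChord_rotation {r : ℝ} (hr : 0 < r) (b : ℝ) :
    (1 - 2 * halfChord r b ^ 2 / r ^ 2) ^ 2 + (2 * halfChord r b * b / r ^ 2) ^ 2 = 1 := by
  rcases le_total 0 (r ^ 2 - b ^ 2) with h | h
  · have := Real.sq_sqrt h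
    rw [halfChord]
    field_simp
    rw [this]
    ring
  · simp [halfChord, Real.sqrt_eq_zero_of_nonpos h]

/-- The effect on `frame c z` of a motion during the time `s` with one collision with the disk
centred at `c`: the impact parameter is conserved, the velocity is rotated by an angle that
depends on the impact parameter only, and the particle jumps from the beginning to the end of the
chord. -/
noncomputable def scatter {r : ℝ} (hr : 0 < r) (s : ℝ) (z : Phase) : Phase :=
  (shear (fun b => s + 2 * halfChord r b) z.1,
    circleMap (rotate _ _ (halfChord_rotation hr (z.1 1))) z.2)

lemma measurePreserving_scatter {r : ℝ} (hr : 0 < r) (s : ℝ) :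
    MeasurePreserving (scatter hr s) phaseVolume phaseVolume := by
  have hk : Measurable (halfChord r) := by unfold halfChord; fun_prop
  refine (measurePreserving_shear (by fun_prop)).skew_product
    (g := fun y v => circleMap (rotate _ _ (halfChord_rotation hr (y 1))) v) ?_
    (ae_of_all _ fun y => (measurePreserving_circleMap _).map_eq)
  refine Measurable.subtype_mk (f := fun p : Phase =>
    rotate _ _ (halfChord_rotation hr (p.1 1)) p.2) ?_
  simp only [rotate_apply]
  have := continuous_perp.measurable
  fun_prop

lemma across_freeFlight (c : Plane) (s : ℝ) (z : Phase) :
    across c (freeFlight s z) = across c z := by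
  rw [across, freeFlight_fst_sub, freeFlight_snd, inner_add_left, real_inner_smul_left, across]
  simp [inner_eq]; right; ring

lemma across_reflectAt (c : Plane) (z : Phase) : across c (reflectAt c z) = across c z := by
  have h := reflection_velocity c z
  change ⟪z.1 - c, perp ((reflectAt c z).2 : Plane)⟫ = ⟪z.1 - c, perp (z.2 : Plane)⟫
  rw [h]
  simp [inner_eq]; ring

lemma frame_freeFlight_reflectAt {r : ℝ} (hr : 0 < r) {c : Plane} {s τ : ℝ} {z : Phase}
    (h : IsHit r c (freeFlight τ z)) :
    frame c (freeFlight (s - τ) (reflectAt c (freeFlight τ z))) =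
      scatter hr s (frame c z) := by
  obtain ⟨h1, h2⟩ := (isHit_freeFlight_iff hr c τ z).1 h
  have hq : √(chordSq r c z) = halfChord r (across c z) := by rw [chordSq_eq, halfChord]
  have hτ : along c z + τ = -halfChord r (across c z) := by rw [h2, entryTime, hq]; ring
  refine Prod.ext ?_ (Subtype.ext ?_)
  · simp only [frame, scatter, shear, along_freeFlight, along_reflectAt, across_freeFlight,
      across_reflectAt]
    change _ = !₂[along c z + (s + 2 * halfChord r (across c z)), across c z]
    congr 2
    linear_combination (-2 : ℝ) * hτ
  · change ((reflectAt c (freeFlight τ z)).2 : Plane) = _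
    rw [reflection_velocity, h.1, sub_eq_along_across c (freeFlight τ z), along_freeFlight,
      across_freeFlight, hτ, freeFlight_snd]
    simp only [scatter, frame, circleMap, rotate_apply]
    ext i
    simp
    ring

end

/-! ### The flow outside the obstacles does not increase volumes -/

section

/-- The states outside the obstacles. On the boundary of an obstacle the velocity must not point
into the obstacle, so that a collision at time `0` has already been carried out. -/
def outside (S : Set Plane) (r : ℝ) : Set Phase := {z | ∀ c ∈ S, r ≤ ‖z.1 - c‖ ∧ ¬ IsHit r c z}

variable {S : Set Plane} {r g : ℝ}

lemma freeFlight_neg_freeFlight (s : ℝ) (z : Phase) : freeFlight (-s) (freeFlight s z) = z := by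
  rw [← freeFlight_add, add_neg_cancel, freeFlight_zero]

lemma reflectAt_reflectAt (c : Plane) (z : Phase) : reflectAt c (reflectAt c z) = z := by
  refine Prod.ext rfl (Subtype.ext ?_)
  change (Submodule.span ℝ {z.1 - c})ᗮ.reflection
    ((Submodule.span ℝ {z.1 - c})ᗮ.reflection (z.2 : Plane)) = _
  rw [Submodule.reflection_reflection]

/-- A particle that comes from outside a disk without hitting it stays outside. -/
lemma le_norm_freeFlight_sub (hr : 0 < r) {c : Plane} {z : Phase} (hz : r ≤ ‖z.1 - c‖) {t : ℝ}
    (ht : 0 ≤ t) (h : ∀ s ∈ Set.Ico 0 t, ¬ IsHit r c (freeFlight s z)) :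
    r ≤ ‖(freeFlight t z).1 - c‖ := by
  by_contra! hlt
  rw [← sq_lt_sq₀ (norm_nonneg _) hr.le, norm_freeFlight_sub_sq] at hlt
  rw [← sq_le_sq₀ hr.le (norm_nonneg _)] at hz
  have hlt' : (along c z + t) ^ 2 < chordSq r c z := by rw [chordSq]; linarith
  have hD : 0 < chordSq r c z := (sq_nonneg _).trans_lt hlt'
  have hq := Real.sqrt_pos.2 hD
  have hab := abs_lt_of_sq_lt_sq (hlt'.trans_eq (Real.sq_sqrt hD.le).symm) hq.le
  rw [abs_lt] at hab
  have hz' : √(chordSq r c z) ^ 2 ≤ along c z ^ 2 := by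
    rw [Real.sq_sqrt hD.le, chordSq]; linarith
  have hqa := sq_le_sq.1 hz'
  rw [abs_of_pos hq] at hqa
  rcases le_abs.1 hqa with h1 | h1
  · linarith
  · refine h (entryTime r c z) ⟨?_, ?_⟩ ((isHit_freeFlight_iff hr _ _ _).2 ⟨hD, rfl⟩)
    · rw [entryTime]; linarith
    · rw [entryTime]; linarith

namespace Separated

lemma reflectAt_mem_outside (hS : Separated S r g) {c : Plane} (hc : c ∈ S) {z : Phase}
    (h : IsHit r c z) : reflectAt c z ∈ outside S r := by
  intro c' hc'
  rcases eq_or_ne c c' with rfl | hne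
  · refine ⟨h.1.ge, ?_⟩
    have := not_isHit_of_along_nonneg (r := r) (along_reflectAt_pos h).le le_rfl
    rwa [freeFlight_zero] at this
  · have h1 := hS.le_dist c hc c' hc' hne
    have h2 := dist_triangle c z.1 c'
    rw [dist_comm c z.1, dist_eq_norm z.1 c, h.1, dist_eq_norm z.1 c'] at h2
    have h3 : r < ‖z.1 - c'‖ := by linarith [hS.gap_pos, hS.radius_pos]
    exact ⟨h3.le, fun h' => h3.ne' h'.1⟩

lemma lorentzFlow_mem_outside (hS : Separated S r g) {t : ℝ} (ht : 0 ≤ t) {z : Phase}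
    (hz : z ∈ outside S r) : lorentzFlow S r t z ∈ outside S r := by
  refine hS.flow_induction (Q := fun t z => z ∈ outside S r → lorentzFlow S r t z ∈ outside S r)
    ?_ ?_ t z ht hz
  · intro t z ht h hz c hc
    rw [hS.lorentzFlow_of_forall_lt h]
    exact ⟨le_norm_freeFlight_sub hS.radius_pos (hz c hc).1 ht fun s hs hh =>
      (h s ⟨hs.1, c, hc, hh⟩).not_gt hs.2, fun hh => lt_irrefl _ (h t ⟨ht, c, hc, hh⟩)⟩
  · intro t z τ hl hτ ih _
    rw [hS.lorentzFlow_of_isLeast hl hτ]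
    obtain ⟨-, c, hc, hh⟩ := hl.1
    rw [hS.collide_eq hc hh] at ih ⊢
    exact ih (hS.reflectAt_mem_outside hc hh)

/-- In a time shorter than the gap there is at most one collision. -/
lemma lorentzFlow_of_isHit (hS : Separated S r g) {t τ : ℝ} (htg : t < g) {z : Phase}
    (hτ : τ ∈ Set.Icc 0 t) {c : Plane} (hc : c ∈ S) (hh : IsHit r c (freeFlight τ z)) :
    lorentzFlow S r t z = freeFlight (t - τ) (reflectAt c (freeFlight τ z)) := by
  have hmem : τ ∈ hitTimes S r z := ⟨hτ.1, c, hc, hh⟩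
  have hl : IsLeast (hitTimes S r z) τ := by
    refine ⟨hmem, fun s hs => ?_⟩
    by_contra! hlt
    have := hS.le_abs_sub hmem hs hlt.ne'
    rw [abs_of_pos (by linarith)] at this
    linarith [hs.1, hτ.2]
  rw [hS.lorentzFlow_of_isLeast hl hτ.2, hS.collide_eq hc hh, hS.lorentzFlow_of_forall_lt]
  intro s hs
  have := hS.le_of_mem_hitTimes_reflectAt hc hh hs
  linarith [hτ.1]

lemma lorentzFlow_short (hS : Separated S r g) (t : ℝ) (z : Phase) :
    ((∀ s ∈ hitTimes S r z, t < s) ∧ lorentzFlow S r t z = freeFlight t z) ∨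
      ∃ c ∈ S, ∃ τ ∈ Set.Icc 0 t, IsHit r c (freeFlight τ z) := by
  rcases hS.forall_lt_or_isLeast t z with h | ⟨τ, hτ, ⟨h0, c, hc, hh⟩, -⟩
  · exact Or.inl ⟨h, hS.lorentzFlow_of_forall_lt h⟩
  · exact Or.inr ⟨c, hc, τ, ⟨h0, hτ⟩, hh⟩

/-- A particle that did not collide and one that did cannot end in the same state: going backwards
in time, the former would enter the disk at which the latter was reflected. -/
lemma free_ne_hit (hS : Separated S r g) {t τ : ℝ} {z w : Phase} (hz : z ∈ outside S r)
    (hw : w ∈ outside S r) (hfree : ∀ s ∈ hitTimes S r z, t < s) (hτ : τ ∈ Set.Icc 0 t)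
    {c : Plane} (hc : c ∈ S) (hh : IsHit r c (freeFlight τ w)) :
    freeFlight t z ≠ freeFlight (t - τ) (reflectAt c (freeFlight τ w)) := by
  intro h
  have hr := hS.radius_pos
  have h1 : freeFlight τ z = reflectAt c (freeFlight τ w) := by
    have := congrArg (freeFlight (-(t - τ))) h
    rw [freeFlight_neg_freeFlight, ← freeFlight_add] at this
    rw [← this]; congr 1; ring
  have hpos := along_reflectAt_pos hh
  rw [← h1, along_freeFlight] at hpos
  have hn : ‖(freeFlight τ z).1 - c‖ = r := by rw [h1]; exact hh.1
  have hD : chordSq r c z = (along c z + τ) ^ 2 := by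
    rw [← chordSq_freeFlight r c τ, chordSq, hn, along_freeFlight]; ring
  have hq : √(chordSq r c z) = along c z + τ := by rw [hD, Real.sqrt_sq hpos.le]
  rcases hτ.1.eq_or_lt with rfl | hτ0
  · rw [freeFlight_zero] at hh
    exact (hw c hc).2 hh
  · have h2 := (sq_le_sq₀ hr.le (norm_nonneg _)).2 (hz c hc).1
    have h3 := norm_freeFlight_sub_sq c τ z
    rw [hn] at h3
    have h4 : along c z * 2 + τ ≤ 0 := by
      by_contra! hcon
      nlinarith
    have hhit : IsHit r c (freeFlight (entryTime r c z) z) :=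
      (isHit_freeFlight_iff hr _ _ _).2 ⟨by rw [hD]; positivity, rfl⟩
    have := hfree _ ⟨by rw [entryTime, hq]; linarith, c, hc, hhit⟩
    rw [entryTime, hq] at this
    linarith [hτ.2]

/-- For times shorter than the gap the flow is injective outside the obstacles. -/
lemma injOn_lorentzFlow (hS : Separated S r g) {t : ℝ} (htg : t < g) :
    Set.InjOn (lorentzFlow S r t) (outside S r) := by
  intro z hz w hw h
  rcases hS.lorentzFlow_short t z with ⟨hfz, hz'⟩ | ⟨c, hc, τ, hτ, hh⟩ <;>
    rcases hS.lorentzFlow_short t w with ⟨hfw, hw'⟩ | ⟨c', hc', τ', hτ', hh'⟩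
  · rw [hz', hw'] at h
    rw [← freeFlight_neg_freeFlight t z, h, freeFlight_neg_freeFlight]
  · rw [hz', hS.lorentzFlow_of_isHit htg hτ' hc' hh'] at h
    exact absurd h (hS.free_ne_hit hz hw hfz hτ' hc' hh')
  · rw [hw', hS.lorentzFlow_of_isHit htg hτ hc hh] at h
    exact absurd h.symm (hS.free_ne_hit hw hz hfw hτ hc hh)
  · rw [hS.lorentzFlow_of_isHit htg hτ hc hh, hS.lorentzFlow_of_isHit htg hτ' hc' hh'] at h
    set p := freeFlight τ z with hp
    set p' := freeFlight τ' w with hp'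
    have hpp : reflectAt c p = freeFlight (τ - τ') (reflectAt c' p') := by
      have := congrArg (freeFlight (-(t - τ))) h
      rw [freeFlight_neg_freeFlight, ← freeFlight_add] at this
      rw [this]; congr 1; ring
    have hd : dist p.1 p'.1 < g := by
      have := dist_freeFlight (τ - τ') 0 (reflectAt c' p')
      rw [← hpp, freeFlight_zero, sub_zero] at this
      change dist p.1 p'.1 = _ at this
      rw [this, abs_lt]
      constructor <;> linarith [hτ.1, hτ.2, hτ'.1, hτ'.2]
    obtain rfl := hS.eq_of_isHit hc hc' hh hh' hd
    have ha := along_reflectAt_pos hh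
    have ha' := along_reflectAt_pos hh'
    have hD : along c (reflectAt c p) ^ 2 = chordSq r c (reflectAt c p) := by
      rw [chordSq, show ‖(reflectAt c p).1 - c‖ = r from hh.1]; ring
    have hD' : along c (reflectAt c p') ^ 2 = chordSq r c (reflectAt c p') := by
      rw [chordSq, show ‖(reflectAt c p').1 - c‖ = r from hh'.1]; ring
    rw [hpp, chordSq_freeFlight, ← hD', ← hpp, sq_eq_sq₀ ha.le ha'.le] at hD
    have hτeq : τ = τ' := by
      rw [hpp, along_freeFlight] at hD; linarith
    rw [hτeq, sub_self, freeFlight_zero] at hpp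
    have := congrArg (reflectAt c) hpp
    rw [reflectAt_reflectAt, reflectAt_reflectAt, hp, hp', hτeq] at this
    rw [← freeFlight_neg_freeFlight τ' z, this, freeFlight_neg_freeFlight]

end Separated

lemma le_measure_image_of_measurePreserving {α β : Type*} [MeasurableSpace α]
    [MeasurableSpace β] {μ : Measure α} {μ' : Measure β} {f : α → β}
    (hf : MeasurePreserving f μ μ') {A : Set α} (hA : MeasurableSet (f '' A)) :
    μ A ≤ μ' (f '' A) := by
  rw [← hf.measure_preimage hA.nullMeasurableSet]
  exact measure_mono (Set.subset_preimage_image f A)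

instance : StandardBorelSpace UnitCircle := by
  have : PolishSpace UnitCircle := Metric.isClosed_sphere.polishSpace
  infer_instance

lemma measurePreserving_freeFlight (s : ℝ) :
    MeasurePreserving (freeFlight s) phaseVolume phaseVolume := by
  have h := (MeasurePreserving.id (volume : Measure Plane).toSphere).skew_product
    (μc := (volume : Measure Plane)) (μd := (volume : Measure Plane))
    (g := fun v x => x + s • (v : Plane)) (by fun_prop)
    (ae_of_all _ fun v => (measurePreserving_add_right volume (s • (v : Plane))).map_eq)
  exact Measure.measurePreserving_swap.comp (h.comp Measure.measurePreserving_swap)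

lemma measurableSet_isHit (r : ℝ) (c : Plane) : MeasurableSet {z : Phase | IsHit r c z} := by
  have h1 : Measurable fun z : Phase => ‖z.1 - c‖ := by fun_prop
  have h2 : Measurable (along c) := measurable_along measurable_const measurable_id
  exact (measurableSet_eq_fun h1 measurable_const).inter
    (measurableSet_lt h2 (measurable_const (a := (0 : ℝ))))

lemma measurableSet_outside (hc : S.Countable) : MeasurableSet (outside S r) := by
  have : outside S r = ⋂ c ∈ S, {z | r ≤ ‖z.1 - c‖} ∩ {z | IsHit r c z}ᶜ := by
    ext z; simp [outside]
  rw [this]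
  refine MeasurableSet.biInter hc fun c _ => ?_
  have h1 : Measurable fun z : Phase => ‖z.1 - c‖ := by fun_prop
  exact (measurableSet_le measurable_const h1).inter (measurableSet_isHit r c).compl

lemma measurableSet_exists_isHit (hr : 0 < r) (c : Plane) (t : ℝ) :
    MeasurableSet {z : Phase | ∃ τ ∈ Set.Icc 0 t, IsHit r c (freeFlight τ z)} := by
  have h1 := measurable_chordSq r (measurable_const (a := c)) (measurable_id (α := Phase))
  have h2 := measurable_entryTime r (measurable_const (a := c)) (measurable_id (α := Phase))
  have : {z : Phase | ∃ τ ∈ Set.Icc 0 t, IsHit r c (freeFlight τ z)} =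
      {z | 0 < chordSq r c z} ∩ {z | entryTime r c z ∈ Set.Icc 0 t} := by
    ext z
    simp only [isHit_freeFlight_iff hr, Set.mem_ofPred_eq, Set.mem_inter_iff]
    constructor
    · rintro ⟨τ, hτ, h, rfl⟩; exact ⟨h, hτ⟩
    · rintro ⟨h, hτ⟩; exact ⟨_, hτ, h, rfl⟩
  rw [this]
  exact (measurableSet_lt measurable_const h1).inter (h2 measurableSet_Icc)

namespace Separated

lemma measure_outside_preimage_le_of_lt (hS : Separated S r g) (hc : S.Countable) {t : ℝ}
    (htg : t < g) {B : Set Phase} (hB : MeasurableSet B) :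
    phaseVolume (outside S r ∩ lorentzFlow S r t ⁻¹' B) ≤ phaseVolume B := by
  have := hc.to_subtype
  have hr := hS.radius_pos
  set T := lorentzFlow S r t with hT
  have hTm : Measurable T := measurable_lorentzFlow_state hS hc t
  set U := outside S r ∩ T ⁻¹' B with hU
  have hUm : MeasurableSet U := (measurableSet_outside hc).inter (hTm hB)
  have hinj : Set.InjOn T U := (hS.injOn_lorentzFlow htg).mono Set.inter_subset_left
  -- `H (some c)` are the states with a collision with `c`, `H none` those without a collision.
  let H : Option S → Set Phase := fun o => o.elim
    (U \ ⋃ c : S, {z | ∃ τ ∈ Set.Icc 0 t, IsHit r (c : Plane) (freeFlight τ z)})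
    fun c => U ∩ {z | ∃ τ ∈ Set.Icc 0 t, IsHit r (c : Plane) (freeFlight τ z)}
  have hHU : ∀ o, H o ⊆ U := by
    rintro (_ | c)
    · exact Set.sdiff_subset
    · exact Set.inter_subset_left
  have hHm : ∀ o, MeasurableSet (H o) := by
    rintro (_ | c)
    · exact hUm.diff (MeasurableSet.iUnion fun c => measurableSet_exists_isHit hr _ _)
    · exact hUm.inter (measurableSet_exists_isHit hr _ _)
  have hcov : U ⊆ ⋃ o, H o := by
    intro z hz
    by_cases h : z ∈ ⋃ c : S, {z | ∃ τ ∈ Set.Icc 0 t, IsHit r (c : Plane) (freeFlight τ z)}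
    · obtain ⟨c, hc⟩ := Set.mem_iUnion.1 h
      exact Set.mem_iUnion.2 ⟨some c, hz, hc⟩
    · exact Set.mem_iUnion.2 ⟨none, hz, h⟩
  have hdisj : Pairwise (Function.onFun Disjoint H) := by
    have h1 : ∀ c : S, Disjoint (H none) (H (some c)) := fun c =>
      Set.disjoint_left.2 fun z h h' => h.2 (Set.mem_iUnion.2 ⟨c, h'.2⟩)
    rintro (_ | c) (_ | c') hne
    · exact absurd rfl hne
    · exact h1 c'
    · exact (h1 c).symm
    · refine Set.disjoint_left.2 ?_
      rintro z ⟨-, τ, hτ, h⟩ ⟨-, τ', hτ', h'⟩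
      refine hne (congrArg some (Subtype.ext (hS.eq_of_isHit c.2 c'.2 h h' ?_)))
      rw [dist_freeFlight, abs_lt]
      constructor <;> linarith [hτ.1, hτ.2, hτ'.1, hτ'.2]
  have himm : ∀ o, MeasurableSet (T '' H o) := fun o =>
    (hHm o).image_of_measurable_injOn hTm (hinj.mono (hHU o))
  have hle : ∀ o, phaseVolume (H o) ≤ phaseVolume (T '' H o) := by
    rintro (_ | c)
    · have hEq : Set.EqOn T (freeFlight t) (H none) := by
        intro z hz
        rcases hS.lorentzFlow_short t z with ⟨-, h⟩ | ⟨c, hc, h⟩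
        · exact h
        · exact absurd (Set.mem_iUnion.2 ⟨⟨c, hc⟩, h⟩) hz.2
      have := himm none
      rw [hEq.image_eq] at this ⊢
      exact le_measure_image_of_measurePreserving (measurePreserving_freeFlight t) this
    · -- In the frame of the disk the flow is the volume preserving map `scatter`.
      have hEq : Set.EqOn (frame (c : Plane) ∘ T) (scatter hr t ∘ frame (c : Plane))
          (H (some c)) := by
        rintro z ⟨-, τ, hτ, h⟩
        simp only [Function.comp_apply, hT]
        rw [hS.lorentzFlow_of_isHit htg hτ c.2 h, frame_freeFlight_reflectAt hr h]
      have hfT : MeasurableSet (frame (c : Plane) '' (T '' H (some c))) :=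
        (himm _).image_of_measurable_injOn (measurable_frame _) (frame_injective _).injOn
      calc phaseVolume (H (some c))
          ≤ phaseVolume ((scatter hr t ∘ frame (c : Plane)) '' H (some c)) := by
            refine le_measure_image_of_measurePreserving
              ((measurePreserving_scatter hr t).comp (measurePreserving_frame _)) ?_
            rwa [← hEq.image_eq, Set.image_comp]
        _ = phaseVolume (frame (c : Plane) '' (T '' H (some c))) := by
            rw [← hEq.image_eq, Set.image_comp]
        _ = phaseVolume (T '' H (some c)) := by
            rw [← (measurePreserving_frame (c : Plane)).measure_preimage hfT.nullMeasurableSet,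
              (frame_injective _).preimage_image]
  calc phaseVolume U ≤ phaseVolume (⋃ o, H o) := measure_mono hcov
    _ ≤ ∑' o, phaseVolume (H o) := measure_iUnion_le _
    _ ≤ ∑' o, phaseVolume (T '' H o) := ENNReal.tsum_le_tsum hle
    _ = phaseVolume (⋃ o, T '' H o) := by
        refine (measure_iUnion (fun o o' hne => ?_) himm).symm
        refine Set.disjoint_left.2 ?_
        rintro - ⟨z, hz, rfl⟩ ⟨w, hw, h⟩
        obtain rfl := hinj (hHU o' hw) (hHU o hz) h
        exact Set.disjoint_left.1 (hdisj hne) hz hw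
    _ ≤ phaseVolume B := by
        refine measure_mono (Set.iUnion_subset fun o => ?_)
        rintro - ⟨z, hz, rfl⟩
        exact (hHU o hz).2

/-- Outside the obstacles the flow does not increase volumes. -/
theorem measure_outside_preimage_le (hS : Separated S r g) (hc : S.Countable) {t : ℝ}
    (ht : 0 ≤ t) {B : Set Phase} (hB : MeasurableSet B) :
    phaseVolume (outside S r ∩ lorentzFlow S r t ⁻¹' B) ≤ phaseVolume B := by
  have key : ∀ n : ℕ, ∀ t, 0 ≤ t → t < (n + 1) * g →
      phaseVolume (outside S r ∩ lorentzFlow S r t ⁻¹' B) ≤ phaseVolume B := by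
    intro n
    induction n with
    | zero => intro t _ ht; exact hS.measure_outside_preimage_le_of_lt hc (by simpa using ht) hB
    | succ n ih =>
      intro t ht htn
      have hg := hS.gap_pos
      -- Split off a short time `s`, keeping the rest below the bound for `n`.
      set k : ℝ := n + 2 with hk
      have hk2 : 2 ≤ k := by rw [hk]; have := n.cast_nonneg (α := ℝ); linarith
      have hk0 : 0 < k := by linarith
      have hs : t / k < g := by
        rw [div_lt_iff₀ hk0]; push_cast at htn; rw [hk]; linarith
      have hs0 : 0 ≤ t / k := by positivity
      have hrest : t - t / k < (n + 1) * g := by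
        have : t - t / k = (n + 1) * (t / k) := by field_simp; rw [hk]; ring
        rw [this]
        have := n.cast_nonneg (α := ℝ)
        gcongr
      have hrest0 : 0 ≤ t - t / k := by
        have := div_le_self ht (by linarith : 1 ≤ k); linarith
      have hm := measurable_lorentzFlow_state hS hc (t - t / k)
      refine le_trans (measure_mono ?_) ((hS.measure_outside_preimage_le_of_lt hc hs
        ((measurableSet_outside hc).inter (hm hB))).trans (ih _ hrest0 hrest))
      rintro z ⟨hz, hzB⟩
      refine ⟨hz, hS.lorentzFlow_mem_outside hs0 hz, ?_⟩
      rw [Set.mem_preimage, ← hS.lorentzFlow_add hs0 hrest0, add_sub_cancel]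
      exact hzB
  obtain ⟨n, hn⟩ := exists_nat_gt (t / g)
  rw [div_lt_iff₀ hS.gap_pos] at hn
  exact key n t ht (by nlinarith [hS.gap_pos])

/-- A particle that starts inside an obstacle has left it after the time `2 * r`. -/
lemma freeFlight_mem_outside (hS : Separated S r g) (hrg : 2 * r ≤ g) {c : Plane} (hc : c ∈ S)
    {z : Phase} (hz : ‖z.1 - c‖ < r) :
    freeFlight (2 * r) z ∈ outside S r ∧ ∀ s ∈ hitTimes S r z, 2 * r < s := by
  have hr := hS.radius_pos
  have hfar : ∀ s, 0 ≤ s → s ≤ 2 * r → ∀ c' ∈ S, c' ≠ c → r < ‖(freeFlight s z).1 - c'‖ := by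
    intro s hs hs' c' hc' hne
    have h1 := hS.le_dist c hc c' hc' hne.symm
    have h2 := dist_triangle4 c z.1 (freeFlight s z).1 c'
    have h3 := dist_freeFlight 0 s z
    rw [freeFlight_zero, zero_sub, abs_neg, abs_of_nonneg hs] at h3
    rw [dist_comm c z.1, dist_eq_norm z.1 c, dist_eq_norm (freeFlight s z).1 c', h3] at h2
    linarith
  have hself : ∀ s, 0 ≤ s → ¬ IsHit r c (freeFlight s z) := by
    rintro s hs ⟨h1, h2⟩
    change along c (freeFlight s z) < 0 at h2
    rw [along_freeFlight] at h2
    have h3 := norm_freeFlight_sub_sq c s z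
    rw [h1] at h3
    have h4 := (sq_lt_sq₀ (norm_nonneg _) hr.le).2 hz
    nlinarith
  refine ⟨fun c' hc' => ?_, ?_⟩
  · rcases eq_or_ne c' c with rfl | hne
    · refine ⟨?_, hself _ (by linarith)⟩
      have h2 : ‖(2 * r) • (z.2 : Plane)‖ = 2 * r := by
        rw [norm_smul, norm_velocity, mul_one, Real.norm_of_nonneg (by linarith)]
      rw [freeFlight_fst_sub]
      have h3 := norm_sub_norm_le ((2 * r) • (z.2 : Plane)) (-(z.1 - c'))
      rw [norm_neg, sub_neg_eq_add, add_comm _ (z.1 - c'), h2] at h3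
      linarith
    · have := hfar (2 * r) (by linarith) le_rfl c' hc' hne
      exact ⟨this.le, fun h => this.ne' h.1⟩
  · rintro s ⟨hs, c', hc', h⟩
    by_contra! hle
    rcases eq_or_ne c' c with rfl | hne
    · exact hself s hs h
    · exact (hfar s hs hle c' hc' hne).ne' h.1

/-- The volume of the initial states that are in `B` at time `t`. The factor `2` accounts for the
particles that start inside an obstacle. -/
theorem measure_preimage_le (hS : Separated S r g) (hrg : 2 * r ≤ g) (hc : S.Countable) {t : ℝ}
    (ht : 0 ≤ t) {B : Set Phase} (hB : MeasurableSet B) :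
    phaseVolume (lorentzFlow S r t ⁻¹' B) ≤ 2 * phaseVolume B := by
  have hr := hS.radius_pos
  set I : Set Phase := {z | ∃ c ∈ S, ‖z.1 - c‖ < r} with hI
  have hsphere : phaseVolume (⋃ c ∈ S, Metric.sphere c r ×ˢ Set.univ) = 0 := by
    rw [measure_biUnion_null_iff hc]
    intro c _
    rw [phaseVolume, Measure.prod_prod, Measure.addHaar_sphere, zero_mul]
  have hin : phaseVolume (I ∩ lorentzFlow S r t ⁻¹' B) ≤ phaseVolume B := by
    rcases le_total (2 * r) t with h | h
    · have hm := measurable_lorentzFlow_state hS hc (t - 2 * r)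
      refine le_trans (measure_mono ?_) (((measurePreserving_freeFlight (2 * r)).measure_preimage
        ((measurableSet_outside hc).inter (hm hB)).nullMeasurableSet).trans_le
          (hS.measure_outside_preimage_le hc (by linarith) hB))
      rintro z ⟨⟨c, hcS, hz⟩, hzB⟩
      obtain ⟨h1, h2⟩ := hS.freeFlight_mem_outside hrg hcS hz
      refine ⟨h1, ?_⟩
      rw [Set.mem_preimage, ← hS.lorentzFlow_freeFlight (by linarith) h2,
        add_sub_cancel]
      exact hzB
    · refine le_trans (measure_mono ?_)
        ((measurePreserving_freeFlight t).measure_preimage hB.nullMeasurableSet).le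
      rintro z ⟨⟨c, hcS, hz⟩, hzB⟩
      obtain ⟨-, h2⟩ := hS.freeFlight_mem_outside hrg hcS hz
      rwa [Set.mem_preimage, ← hS.lorentzFlow_of_forall_lt fun s hs => h.trans_lt (h2 s hs)]
  have hcov : lorentzFlow S r t ⁻¹' B ⊆ (outside S r ∩ lorentzFlow S r t ⁻¹' B) ∪
      (I ∩ lorentzFlow S r t ⁻¹' B) ∪ ⋃ c ∈ S, Metric.sphere c r ×ˢ Set.univ := by
    intro z hz
    by_cases h1 : z ∈ outside S r
    · exact Or.inl (Or.inl ⟨h1, hz⟩)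
    · simp only [outside, Set.mem_ofPred_eq, not_forall] at h1
      obtain ⟨c, hcS, h⟩ := h1
      rcases lt_or_ge ‖z.1 - c‖ r with h2 | h2
      · exact Or.inl (Or.inr ⟨⟨c, hcS, h2⟩, hz⟩)
      · refine Or.inr (Set.mem_biUnion hcS ⟨?_, Set.mem_univ _⟩)
        have h3 : IsHit r c z := by
          by_contra h3; exact h ⟨h2, h3⟩
        rw [mem_sphere_iff_norm]
        exact h3.1
  calc phaseVolume (lorentzFlow S r t ⁻¹' B) ≤ _ := measure_mono hcov
    _ ≤ _ := measure_union_le _ _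
    _ ≤ _ := add_le_add_left (measure_union_le _ _) _
    _ ≤ (phaseVolume B + phaseVolume B) + 0 := by
        rw [hsphere]
        exact add_le_add (add_le_add (hS.measure_outside_preimage_le hc ht hB) hin) le_rfl
    _ = 2 * phaseVolume B := by rw [add_zero, two_mul]

end Separated

end

/-! ### Resampling the coordinates that a stopping set has not revealed -/

section

section Resampling

variable {Ω J E : Type*} [MeasurableSpace Ω] [MeasurableSpace E]

open Classical in
/-- The configuration that agrees with `x` on `a` and with `y` off `a`. -/
noncomputable def glue (a : Finset J) (x y : J → E) : J → E := fun j => if j ∈ a then x j else y j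

/-- The law `μ` of a random configuration is invariant under replacing the coordinates off a finite
set by those of an independent copy. This is all that is used of the independence of the
coordinates. -/
def ResamplingInvariant (μ : Measure (J → E)) : Prop :=
  ∀ a : Finset J, (μ.prod μ).map (fun p => glue a p.1 p.2) = μ

lemma measurable_glue (a : Finset J) :
    Measurable fun p : (J → E) × (J → E) => glue a p.1 p.2 := by
  refine measurable_pi_iff.2 fun j => ?_
  by_cases h : j ∈ a
  · simp only [glue, h, if_true]; fun_prop
  · simp only [glue, h, if_false]; fun_prop

lemma indepFun_restrict_compl {P : Measure Ω} {ξ : J → Ω → E} (hm : ∀ j, Measurable (ξ j))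
    (hi : iIndepFun ξ P) (a : Finset J) :
    IndepFun (fun ω (j : {j // j ∈ a}) => ξ j ω) (fun ω (j : {j // j ∉ a}) => ξ j ω) P := by
  have h := indep_iSup_of_disjoint (fun j => (hm j).comap_le) hi
    (S := (a : Set J)) (T := (a : Set J)ᶜ) disjoint_compl_right
  rw [IndepFun_iff_Indep]
  refine indep_of_indep_of_le_left (indep_of_indep_of_le_right h ?_) ?_
  · refine Measurable.comap_le (m₁ := ⨆ j ∈ (a : Set J)ᶜ, MeasurableSpace.comap (ξ j) _)
      (@measurable_pi_lambda _ _ _ (_) _ _ fun j => ?_)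
    exact Measurable.of_comap_le (le_iSup₂_of_le (j : J) (by simp) le_rfl)
  · refine Measurable.comap_le (m₁ := ⨆ j ∈ (a : Set J), MeasurableSpace.comap (ξ j) _)
      (@measurable_pi_lambda _ _ _ (_) _ _ fun j => ?_)
    exact Measurable.of_comap_le (le_iSup₂_of_le (j : J) (by simp) le_rfl)

theorem resamplingInvariant_map {P : Measure Ω} [IsProbabilityMeasure P] {ξ : J → Ω → E}
    (hm : ∀ j, Measurable (ξ j)) (hi : iIndepFun ξ P) :
    ResamplingInvariant (P.map fun ω j => ξ j ω) := by
  classical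
  intro a
  have hX : Measurable fun ω j => ξ j ω := measurable_pi_iff.2 hm
  have hY : Measurable fun ω (j : {j // j ∈ a}) => ξ j ω := measurable_pi_iff.2 fun j => hm j
  have hW : Measurable fun ω (j : {j // j ∉ a}) => ξ j ω := measurable_pi_iff.2 fun j => hm j
  let join : ({j // j ∈ a} → E) × ({j // j ∉ a} → E) → J → E :=
    fun p j => if h : j ∈ a then p.1 ⟨j, h⟩ else p.2 ⟨j, h⟩
  have hjoin : Measurable join := by
    refine measurable_pi_iff.2 fun j => ?_
    by_cases h : j ∈ a
    · simp only [join, h, dif_pos]; fun_prop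
    · simp only [join, h, dif_neg, not_false_eq_true]; fun_prop
  have h := (indepFun_iff_map_prod_eq_prod_map_map hY.aemeasurable hW.aemeasurable).1
    (indepFun_restrict_compl hm hi a)
  rw [Measure.map_prod_map _ _ hX hX, Measure.map_map (measurable_glue a) (hX.prodMap hX)]
  rw [Measure.map_prod_map _ _ hY hW] at h
  have h' := congrArg (Measure.map join) h
  rw [Measure.map_map hjoin (hY.prodMk hW), Measure.map_map hjoin (hY.prodMap hW)] at h'
  convert h'.symm using 2
  · ext p j
    by_cases h : j ∈ a <;> simp [glue, join, h]
  · ext p j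
    by_cases h : j ∈ a <;> simp [join, h]

variable [Countable J]

/-- A stopping set: a random finite set of coordinates with the property that whether it equals `a`
is decided by the coordinates in `a`. -/
structure IsStoppingSet (A : (J → E) → Finset J) : Prop where
  measurableSet : ∀ a, MeasurableSet {x | A x = a}
  adapted : ∀ x y, (∀ j ∈ A x, x j = y j) → A y = A x

lemma measurable_glue_stoppingSet {A : (J → E) → Finset J} (hA : IsStoppingSet A) :
    Measurable fun p : (J → E) × (J → E) => glue (A p.1) p.1 p.2 :=
  measurable_of_eqOn_cover (ι := Finset J) (A := fun a => {p | A p.1 = a})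
    (F := fun a p => glue a p.1 p.2) (F₀ := fun p => p.1)
    (fun a => measurable_fst (hA.measurableSet a)) measurable_glue measurable_fst
    (by rintro a p rfl; rfl) (fun p hp => absurd rfl (hp (A p.1)))

lemma measure_eq_tsum_inter {α ι : Type*} [MeasurableSpace α] [Countable ι] (μ : Measure α)
    {f : α → ι} (hf : ∀ i, MeasurableSet {a | f a = i}) {B : Set α} (hB : MeasurableSet B) :
    μ B = ∑' i, μ (B ∩ {a | f a = i}) := by
  rw [← measure_iUnion _ fun i => hB.inter (hf i)]
  · congr 1; ext a; simp
  · intro i k hik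
    refine Set.disjoint_left.2 ?_
    rintro a ⟨-, rfl⟩ ⟨-, h⟩
    exact hik h

/-- The strong Markov property for stopping sets: the coordinates off a stopping set can be
resampled without changing the law of the configuration. -/
theorem ResamplingInvariant.map_glue {μ : Measure (J → E)} [SFinite μ]
    (hμ : ResamplingInvariant μ) {A : (J → E) → Finset J} (hA : IsStoppingSet A) :
    (μ.prod μ).map (fun p => glue (A p.1) p.1 p.2) = μ := by
  ext B hB
  rw [Measure.map_apply (measurable_glue_stoppingSet hA) hB,
    measure_eq_tsum_inter (μ.prod μ) (f := fun p => A p.1)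
      (fun a => measurable_fst (hA.measurableSet a)) (measurable_glue_stoppingSet hA hB),
    measure_eq_tsum_inter μ hA.measurableSet hB]
  refine tsum_congr fun a => ?_
  conv_rhs => rw [← hμ a, Measure.map_apply (measurable_glue a) (hB.inter (hA.measurableSet a))]
  congr 1
  ext ⟨x, y⟩
  simp only [Set.mem_inter_iff, Set.mem_preimage, Set.mem_ofPred_eq]
  constructor
  · rintro ⟨hB', rfl⟩
    refine ⟨hB', hA.adapted x _ fun j hj => ?_⟩
    simp [glue, hj]
  · rintro ⟨hB', h⟩
    have : A x = a := (hA.adapted (glue a x y) x fun j hj => by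
      rw [h] at hj; simp [glue, hj]).trans h
    exact ⟨by rwa [this], this⟩

/-- Two observables of the same configuration are almost uncorrelated if the first one is decided
by a stopping set `A`, the second one by the coordinates in a set `V`, and for independent
configurations `x`, `y` the sets `A x` and `V y` rarely meet. -/
theorem ResamplingInvariant.enorm_covariance_le {μ : Measure (J → E)} [IsProbabilityMeasure μ]
    (hμ : ResamplingInvariant μ) {A : (J → E) → Finset J} (hA : IsStoppingSet A)
    {V : (J → E) → Set J} {F₁ F₂ : (J → E) → ℝ} (hF₁ : Measurable F₁) (hF₂ : Measurable F₂)
    {G₁ G₂ : ℝ} (hG₁ : ∀ x, ‖F₁ x‖ ≤ G₁) (hG₂ : ∀ x, ‖F₂ x‖ ≤ G₂)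
    (hAF : ∀ x y, (∀ j ∈ A x, x j = y j) → F₁ y = F₁ x)
    (hVF : ∀ x y, (∀ j ∈ V x, x j = y j) → F₂ y = F₂ x) :
    ‖(∫ x, F₁ x * F₂ x ∂μ) - (∫ x, F₁ x ∂μ) * ∫ x, F₂ x ∂μ‖ₑ ≤
      ENNReal.ofReal (2 * G₁ * G₂) * (μ.prod μ) {p | ∃ j ∈ A p.1, j ∈ V p.2} := by
  have hgm := measurable_glue_stoppingSet hA
  have hglue : ∀ p : (J → E) × (J → E), F₁ (glue (A p.1) p.1 p.2) = F₁ p.1 := fun p =>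
    hAF _ _ fun j hj => by simp [glue, hj]
  have h1 : ∫ x, F₁ x * F₂ x ∂μ =
      ∫ p, F₁ p.1 * F₂ (glue (A p.1) p.1 p.2) ∂(μ.prod μ) := by
    conv_lhs => rw [← hμ.map_glue hA]
    rw [integral_map hgm.aemeasurable 
      (f := fun x => F₁ x * F₂ x) (hF₁.mul hF₂).aestronglyMeasurable]
    simp only [hglue]
  have hbound : ∀ (k : (J → E) × (J → E) → J → E), Measurable k →
      Integrable (fun p : (J → E) × (J → E) => F₁ p.1 * F₂ (k p)) (μ.prod μ) := fun k hk => by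
    refine Integrable.of_bound (C := G₁ * G₂)
      ((hF₁.comp measurable_fst).mul (hF₂.comp hk)).aestronglyMeasurable
      (ae_of_all _ fun p => ?_)
    rw [norm_mul]
    exact mul_le_mul (hG₁ _) (hG₂ _) (norm_nonneg _) ((norm_nonneg _).trans (hG₁ p.1))
  rw [h1, ← integral_prod_mul, ← integral_sub (hbound _ hgm) (hbound _ measurable_snd)]
  refine (enorm_integral_le_lintegral_enorm _).trans ?_
  refine le_trans (lintegral_mono fun p => ?_) (lintegral_indicator_const_le
    {p : (J → E) × (J → E) | ∃ j ∈ A p.1, j ∈ V p.2} (ENNReal.ofReal (2 * G₁ * G₂)))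
  by_cases hp : ∃ j ∈ A p.1, j ∈ V p.2
  · rw [Set.indicator_of_mem (by exact hp), ← ofReal_norm]
    refine ENNReal.ofReal_le_ofReal ?_
    rw [← mul_sub, norm_mul]
    calc ‖F₁ p.1‖ * ‖F₂ (glue (A p.1) p.1 p.2) - F₂ p.2‖ ≤ G₁ * (G₂ + G₂) :=
          mul_le_mul (hG₁ _) ((norm_sub_le _ _).trans (add_le_add (hG₂ _) (hG₂ _)))
            (norm_nonneg _) ((norm_nonneg _).trans (hG₁ p.1))
      _ = 2 * G₁ * G₂ := by ring
  · rw [Set.indicator_of_notMem (by exact hp), hVF p.2 (glue (A p.1) p.1 p.2), sub_self, enorm_zero]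
    intro j hj
    have : j ∉ A p.1 := fun h => hp ⟨j, h, hj⟩
    simp [glue, this]

lemma prod_exists_mem_le (μ : Measure (J → E)) [SFinite μ] (A V : (J → E) → Set J) :
    (μ.prod μ) {p | ∃ j ∈ A p.1, j ∈ V p.2} ≤ ∑' j, μ {x | j ∈ A x} * μ {x | j ∈ V x} := by
  have : {p : (J → E) × (J → E) | ∃ j ∈ A p.1, j ∈ V p.2} =
      ⋃ j, {x | j ∈ A x} ×ˢ {x | j ∈ V x} := by
    ext p; simp
  rw [this]
  exact (measure_iUnion_le _).trans (ENNReal.tsum_le_tsum fun j => (Measure.prod_prod _ _).le)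

end Resampling

end

/-! ### The perturbed lattice and the sites that a trajectory visits -/

section

/-- Configurations of perturbations of the lattice points. -/
abbrev Config : Type := ℤ × ℤ → Plane

open Classical in
/-- Perturbations of norm at least `1`, which have probability zero, are set to `0`. -/
noncomputable def clip (y : Plane) : Plane := if ‖y‖ < 1 then y else 0

/-- The centre of the obstacle with index `j` for lattice spacing `L` and relative size `e` of the
perturbation. -/
noncomputable def center (L e : ℝ) (x : Config) (j : ℤ × ℤ) : Plane :=
  L • (latticePoint j + e • clip (x j))

/-- The Lorentz flow among the obstacles of radius `r` with the centres `center L e x j`. -/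
noncomputable def latticeFlow (L e r : ℝ) (x : Config) (t : ℝ) (z : Phase) : Phase :=
  lorentzFlow (Set.range (center L e x)) r t z

/-- The sites `j` whose lattice point `L j` has distance at most `L * e + r + h` from the position
of the particle at some time in `[0, t]` that is a multiple of the time step `h`. They include
all sites whose obstacle the particle can meet up to time `t`. -/
def visited (L e r h t : ℝ) (z : Phase) (x : Config) : Set (ℤ × ℤ) :=
  {j | ∃ k : ℕ, k * h ≤ t ∧
    dist (latticeFlow L e r x (k * h) z).1 (L • latticePoint j) ≤ L * e + r + h}

/-- The perturbation and the radius of the obstacles are small compared to the lattice spacing. -/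
structure SmallScale (L e r : ℝ) : Prop where
  spacing_pos : 0 < L
  size_nonneg : 0 ≤ e
  radius_pos : 0 < r
  size_le : e ≤ 1 / 8
  radius_le : r ≤ L / 16

lemma norm_clip_le (y : Plane) : ‖clip y‖ ≤ 1 := by
  unfold clip
  split_ifs with h
  · exact h.le
  · simp

lemma measurable_clip : Measurable clip :=
  Measurable.ite (measurableSet_lt measurable_norm measurable_const) measurable_id
    measurable_const

lemma one_le_dist_latticePoint {j k : ℤ × ℤ} (h : j ≠ k) :
    1 ≤ dist (latticePoint j) (latticePoint k) := by
  rw [dist_eq_norm, ← one_le_sq_iff₀ (norm_nonneg _), norm_sq_eq]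
  simp only [latticePoint, PiLp.sub_apply, Matrix.cons_val_zero, Matrix.cons_val_one]
  have : (1 : ℤ) ≤ (j.1 - k.1) ^ 2 + (j.2 - k.2) ^ 2 := by
    by_contra! hlt
    have h1 : j.1 - k.1 = 0 := by
      by_contra h1; have := sq_nonneg (j.2 - k.2); have := sq_pos_of_ne_zero h1; omega
    have h2 : j.2 - k.2 = 0 := by
      by_contra h2; have := sq_nonneg (j.1 - k.1); have := sq_pos_of_ne_zero h2; omega
    exact h (Prod.ext (by omega) (by omega))
  exact_mod_cast this

variable {L e r h t : ℝ}

namespace SmallScale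

lemma le_dist (hs : SmallScale L e r) {j k : ℤ × ℤ} (hjk : j ≠ k) :
    L ≤ dist (L • latticePoint j) (L • latticePoint k) := by
  rw [dist_smul₀, Real.norm_of_nonneg hs.spacing_pos.le]
  exact le_mul_of_one_le_right hs.spacing_pos.le (one_le_dist_latticePoint hjk)

lemma dist_center_le (hs : SmallScale L e r) (x : Config) (j : ℤ × ℤ) :
    dist (center L e x j) (L • latticePoint j) ≤ L * e := by
  rw [center, smul_add, dist_eq_norm, add_sub_cancel_left, norm_smul, norm_smul,
    Real.norm_of_nonneg hs.spacing_pos.le, Real.norm_of_nonneg hs.size_nonneg]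
  have := norm_clip_le (x j)
  have := hs.spacing_pos
  have := hs.size_nonneg
  calc L * (e * ‖clip (x j)‖) ≤ L * (e * 1) := by gcongr
    _ = L * e := by ring

lemma mul_le (hs : SmallScale L e r) : L * e ≤ L / 8 := by
  have := mul_le_mul_of_nonneg_left hs.size_le hs.spacing_pos.le
  linarith

lemma separated (hs : SmallScale L e r) (x : Config) :
    Separated (Set.range (center L e x)) r (L / 4) where
  radius_pos := hs.radius_pos
  gap_pos := by have := hs.spacing_pos; positivity
  le_dist := by
    rintro - ⟨j, rfl⟩ - ⟨k, rfl⟩ hne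
    have hjk : j ≠ k := fun h => hne (congrArg _ h)
    have h1 := hs.le_dist hjk
    have h2 := dist_triangle4 (L • latticePoint j) (center L e x j) (center L e x k)
      (L • latticePoint k)
    have h3 := hs.dist_center_le x j
    have h4 := hs.dist_center_le x k
    rw [dist_comm] at h3
    linarith [hs.mul_le, hs.radius_le, hs.spacing_pos]

lemma measurable_latticeFlow (hs : SmallScale L e r) (t : ℝ) {Y : Type*} [MeasurableSpace Y]
    {X : Y → Config} {z : Y → Phase} (hX : Measurable X) (hz : Measurable z) :
    Measurable fun y => latticeFlow L e r (X y) t (z y) := by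
  have hc : ∀ j, Measurable fun x : Config => center L e x j := fun j => by
    have := measurable_clip
    unfold center
    fun_prop
  have h1 : Measurable fun p : Config × ℝ × Phase => latticeFlow L e r p.1 p.2.1 p.2.2 :=
    measurable_lorentzFlow (c := fun j x => center L e x j) hc hs.separated
  -- The unifier must not unfold the flow.
  generalize latticeFlow L e r = F at h1 ⊢
  exact h1.comp (hX.prodMk (measurable_const.prodMk hz))

lemma measurableSet_near (hs : SmallScale L e r) (t d : ℝ) (j : ℤ × ℤ) :
    MeasurableSet {p : Config × Phase |
      dist (latticeFlow L e r p.1 t p.2).1 (L • latticePoint j) ≤ d} :=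
  measurableSet_le ((hs.measurable_latticeFlow t measurable_fst measurable_snd).fst.dist
    measurable_const) measurable_const

lemma measurableSet_mem_visited (hs : SmallScale L e r) (h t : ℝ) (j : ℤ × ℤ) :
    MeasurableSet {p : Config × Phase | j ∈ visited L e r h t p.2 p.1} := by
  have : {p : Config × Phase | j ∈ visited L e r h t p.2 p.1} = ⋃ k : ℕ, {p : Config × Phase |
      k * h ≤ t ∧ dist (latticeFlow L e r p.1 (k * h) p.2).1 (L • latticePoint j) ≤
        L * e + r + h} := by
    ext p; simp [visited]
  rw [this]
  exact MeasurableSet.iUnion fun k => (MeasurableSet.const _).inter (hs.measurableSet_near _ _ j)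

/-- The trajectory up to time `t` depends on the perturbations at the visited sites only. -/
theorem latticeFlow_congr (hs : SmallScale L e r) (hh : 0 < h) {x y : Config} {z : Phase}
    (hxy : ∀ j ∈ visited L e r h t z x, x j = y j) {s : ℝ} (hs0 : 0 ≤ s) (hst : s ≤ t) :
    latticeFlow L e r y s z = latticeFlow L e r x s z := by
  refine lorentzFlow_congr (hs.separated x) (hs.separated y) hs0 z fun j hj u hu => ?_
  have hjv : j ∉ visited L e r h t z x := fun hjv => hj (by rw [center, center, hxy j hjv])
  -- Compare with the last multiple of `h` before `u`.
  set k := ⌊u / h⌋₊ with hk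
  have hku : k * h ≤ u := (le_div_iff₀ hh).1 (Nat.floor_le (div_nonneg hu.1 hh.le))
  have huk : u < (k + 1) * h := (div_lt_iff₀ hh).1 (Nat.lt_floor_add_one _)
  have hfar : L * e + r + h <
      dist (latticeFlow L e r x (k * h) z).1 (L • latticePoint j) := by
    by_contra! hle
    exact hjv ⟨k, by linarith [hu.2], hle⟩
  have hlip := (hs.separated x).dist_lorentzFlow_le (by positivity : (0 : ℝ) ≤ k * h) hku z
  change dist (latticeFlow L e r x u z).1 (latticeFlow L e r x (k * h) z).1 ≤ _ at hlip
  rw [dist_comm] at hlip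
  have key : ∀ c, dist c (L • latticePoint j) ≤ L * e →
      r < ‖(latticeFlow L e r x u z).1 - c‖ := by
    intro c hc
    have := dist_triangle4 (latticeFlow L e r x (k * h) z).1 (latticeFlow L e r x u z).1 c
      (L • latticePoint j)
    rw [← dist_eq_norm]
    linarith
  exact ⟨key _ (hs.dist_center_le x j), key _ (hs.dist_center_le y j)⟩

lemma visited_congr (hs : SmallScale L e r) (hh : 0 < h) {x y : Config} {z : Phase}
    (hxy : ∀ j ∈ visited L e r h t z x, x j = y j) :
    visited L e r h t z y = visited L e r h t z x := by
  ext j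
  refine exists_congr fun k => and_congr_right fun hk => ?_
  rw [hs.latticeFlow_congr hh hxy (by positivity) hk]

/-- A point is close to at most one lattice point. -/
lemma eq_of_near (hs : SmallScale L e r) {p : Plane} {j k : ℤ × ℤ}
    (hj : dist p (L • latticePoint j) ≤ L * e + r + L / 8)
    (hk : dist p (L • latticePoint k) ≤ L * e + r + L / 8) : j = k := by
  by_contra hne
  have h1 := hs.le_dist hne
  have h2 := dist_triangle_left (L • latticePoint j) (L • latticePoint k) p
  linarith [hs.mul_le, hs.radius_le, hs.spacing_pos]

lemma mem_range_of_mul_le (hh : 0 < h) {k : ℕ} (hk : k * h ≤ t) :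
    k ∈ Finset.range (⌊t / h⌋₊ + 1) :=
  Finset.mem_range.2 (Nat.lt_succ_of_le (Nat.le_floor ((le_div_iff₀ hh).2 hk)))

lemma finite_visited (hs : SmallScale L e r) (t : ℝ) (z : Phase) (x : Config) :
    (visited L e r (L / 8) t z x).Finite := by
  have hh : 0 < L / 8 := by have := hs.spacing_pos; positivity
  refine Set.Finite.subset (s := ⋃ k ∈ Finset.range (⌊t / (L / 8)⌋₊ + 1),
    {j | dist (latticeFlow L e r x (k * (L / 8)) z).1 (L • latticePoint j) ≤ L * e + r + L / 8})
    (Set.Finite.biUnion (Finset.finite_toSet _) fun k _ => Set.Subsingleton.finite ?_) ?_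
  · intro i hi j hj
    exact hs.eq_of_near hi hj
  · rintro j ⟨k, hk, hkj⟩
    exact Set.mem_biUnion (mem_range_of_mul_le hh hk) hkj

/-- The sites visited by a trajectory, for a time step so long that there are few of them. -/
noncomputable def revealed (hs : SmallScale L e r) (t : ℝ) (z : Phase) (x : Config) :
    Finset (ℤ × ℤ) := (hs.finite_visited t z x).toFinset

lemma mem_revealed (hs : SmallScale L e r) {t : ℝ} {z : Phase} {x : Config} {j : ℤ × ℤ} :
    j ∈ hs.revealed t z x ↔ j ∈ visited L e r (L / 8) t z x := Set.Finite.mem_toFinset _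

lemma isStoppingSet_revealed (hs : SmallScale L e r) (t : ℝ) (z : Phase) :
    IsStoppingSet (hs.revealed t z) where
  measurableSet a := by
    have : {x | hs.revealed t z x = a} =
        ⋂ j, {x | j ∈ visited L e r (L / 8) t z x ↔ j ∈ a} := by
      ext x; simp [Finset.ext_iff, mem_revealed]
    rw [this]
    refine MeasurableSet.iInter fun j => measurableSet_setOfPred.2 ?_
    have h1 : MeasurableSet {x | j ∈ visited L e r (L / 8) t z x} :=
      (measurable_id.prodMk measurable_const : Measurable fun x : Config => (x, z))
        (hs.measurableSet_mem_visited (L / 8) t j)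
    exact (measurableSet_setOfPred.1 h1).iff measurable_const
  adapted x y hxy := by
    have hh : 0 < L / 8 := by have := hs.spacing_pos; positivity
    ext j
    rw [mem_revealed, mem_revealed, hs.visited_congr hh fun j hj => hxy j (hs.mem_revealed.2 hj)]

/-- The expected number of sites visited with the time step `L / 8`: one for each step. -/
lemma tsum_measure_mem_visited_le (hs : SmallScale L e r) (μ : Measure Config)
    [IsProbabilityMeasure μ] (t : ℝ) (z : Phase) :
    ∑' j, μ {x | j ∈ visited L e r (L / 8) t z x} ≤ (⌊t / (L / 8)⌋₊ + 1 : ℕ) := by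
  have hh : 0 < L / 8 := by have := hs.spacing_pos; positivity
  set N := ⌊t / (L / 8)⌋₊ + 1
  set W : ℕ → ℤ × ℤ → Set Config := fun k j =>
    {x | dist (latticeFlow L e r x (k * (L / 8)) z).1 (L • latticePoint j) ≤ L * e + r + L / 8}
  have hW : ∀ k j, MeasurableSet (W k j) := fun k j =>
    (measurable_id.prodMk measurable_const : Measurable fun x : Config => (x, z))
      (hs.measurableSet_near _ _ j)
  calc ∑' j, μ {x | j ∈ visited L e r (L / 8) t z x}
      ≤ ∑' j, ∑ k ∈ Finset.range N, μ (W k j) := by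
        refine ENNReal.tsum_le_tsum fun j => ?_
        refine (measure_mono ?_).trans (measure_biUnion_finset_le _ _)
        rintro x ⟨k, hk, hkj⟩
        exact Set.mem_biUnion (mem_range_of_mul_le hh hk) hkj
    _ = ∑ k ∈ Finset.range N, ∑' j, μ (W k j) :=
        Summable.tsum_finsetSum fun _ _ => ENNReal.summable
    _ ≤ ∑ k ∈ Finset.range N, 1 := by
        refine Finset.sum_le_sum fun k _ => ?_
        refine (tsum_measure_le_measure_univ (fun j => (hW k j).nullMeasurableSet)
          fun i j hij => ?_).trans_eq measure_univ
        refine (Set.disjoint_left.2 fun x hi hj => hij (hs.eq_of_near hi hj)).aedisjoint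
    _ = (N : ℕ) := by simp

/-- The total arc length times the area of the unit disk. -/
noncomputable def unitVolume : ℝ≥0∞ :=
  volume (Metric.ball (0 : Plane) 1) * (volume : Measure Plane).toSphere Set.univ

lemma unitVolume_ne_top : unitVolume ≠ ∞ :=
  ENNReal.mul_ne_top measure_ball_lt_top.ne (measure_ne_top _ _)

/-- The volume of the initial states from which a given site is visited. -/
lemma phaseVolume_mem_visited_le (hs : SmallScale L e r) (hh : 0 < h) (t : ℝ) (x : Config)
    (j : ℤ × ℤ) :
    phaseVolume {z | j ∈ visited L e r h t z x} ≤ (⌊t / h⌋₊ + 1 : ℕ) *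
      (2 * (ENNReal.ofReal ((L * e + r + h) ^ 2) * unitVolume)) := by
  set d := L * e + r + h with hd
  have hd0 : 0 ≤ d := by
    have := mul_nonneg hs.spacing_pos.le hs.size_nonneg
    linarith [hs.radius_pos]
  set B : Set Phase := Metric.closedBall (L • latticePoint j) d ×ˢ Set.univ
  have hB : MeasurableSet B := measurableSet_closedBall.prod MeasurableSet.univ
  have hvol : phaseVolume B = ENNReal.ofReal (d ^ 2) * unitVolume := by
    rw [phaseVolume, Measure.prod_prod, Measure.addHaar_closedBall _ _ hd0, unitVolume, mul_assoc]
    simp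
  have hc : (Set.range (center L e x)).Countable := Set.countable_range _
  have hrg : 2 * r ≤ L / 4 := by linarith [hs.radius_le, hs.spacing_pos]
  calc phaseVolume {z | j ∈ visited L e r h t z x}
      ≤ ∑ k ∈ Finset.range (⌊t / h⌋₊ + 1),
          phaseVolume (lorentzFlow (Set.range (center L e x)) r (k * h) ⁻¹' B) := by
        refine (measure_mono ?_).trans (measure_biUnion_finset_le _ _)
        rintro z ⟨k, hk, hkj⟩
        exact Set.mem_biUnion (mem_range_of_mul_le hh hk) ⟨hkj, Set.mem_univ _⟩
    _ ≤ ∑ k ∈ Finset.range (⌊t / h⌋₊ + 1), 2 * phaseVolume B :=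
        Finset.sum_le_sum fun k _ =>
          (hs.separated x).measure_preimage_le hrg hc (by positivity) hB
    _ = _ := by simp [hvol]

lemma lintegral_measure_mem_visited_le (hs : SmallScale L e r) (hh : 0 < h) (t : ℝ)
    (μ : Measure Config) [IsProbabilityMeasure μ] (j : ℤ × ℤ) :
    ∫⁻ z, μ {x | j ∈ visited L e r h t z x} ∂phaseVolume ≤ (⌊t / h⌋₊ + 1 : ℕ) *
      (2 * (ENNReal.ofReal ((L * e + r + h) ^ 2) * unitVolume)) := by
  have hm := hs.measurableSet_mem_visited h t j
  have h1 := Measure.prod_apply_symm (μ := μ) (ν := phaseVolume) hm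
  have h2 := Measure.prod_apply (μ := μ) (ν := phaseVolume) hm
  calc _ = (μ.prod phaseVolume) {p : Config × Phase | j ∈ visited L e r h t p.2 p.1} := h1.symm
    _ = ∫⁻ x, phaseVolume {z | j ∈ visited L e r h t z x} ∂μ := h2
    _ ≤ ∫⁻ _, _ ∂μ := lintegral_mono fun x => hs.phaseVolume_mem_visited_le hh t x j
    _ = _ := by rw [lintegral_const, measure_univ, mul_one]

end SmallScale

end

/-! ### Two trajectories rarely visit the same site -/

section

section Meeting

variable {L e r : ℝ}

/-- The probability that, in two independent configurations, trajectories from `z` and `z'` visit a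
common site. The two trajectories are watched with different time steps: a long one, for which
few sites are visited, and a short one, for which a given site is visited with small
probability. -/
noncomputable def meetingProb (hs : SmallScale L e r) (t : ℝ) (μ : Measure Config)
    (z z' : Phase) : ℝ≥0∞ :=
  (μ.prod μ) {p | ∃ j ∈ hs.revealed t z p.1, j ∈ visited L e r (L * e + r) t z' p.2}

/-- The bound for the expected number of visited sites, times the volume of the initial states
from which a given site is visited. -/
noncomputable def meetingBound (L e r t : ℝ) : ℝ≥0∞ :=
  (⌊t / (L / 8)⌋₊ + 1 : ℕ) * ((⌊t / (L * e + r)⌋₊ + 1 : ℕ) *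
    (2 * (ENNReal.ofReal ((L * e + r + (L * e + r)) ^ 2) * SmallScale.unitVolume)))

lemma SmallScale.reach_pos (hs : SmallScale L e r) : 0 < L * e + r :=
  add_pos_of_nonneg_of_pos (mul_nonneg hs.spacing_pos.le hs.size_nonneg) hs.radius_pos

lemma lintegral_meetingProb_le (hs : SmallScale L e r) (t : ℝ) (μ : Measure Config)
    [IsProbabilityMeasure μ] {F : Phase → ℝ≥0∞} (hF : AEMeasurable F phaseVolume)
    (hF1 : ∫⁻ z, F z ∂phaseVolume = 1) (K : ℝ≥0∞) :
    ∫⁻ p, F p.1 * F p.2 * meetingProb hs t μ p.1 p.2 ∂(phaseVolume.prod phaseVolume) ≤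
      (∫⁻ z, (F z - K) ∂phaseVolume) + K * meetingBound L e r t := by
  have hδ := hs.reach_pos
  set q₁ : ℤ × ℤ → Phase → ℝ≥0∞ := fun j z => μ {x | j ∈ visited L e r (L / 8) t z x} with hq₁
  set q₂ : ℤ × ℤ → Phase → ℝ≥0∞ := fun j z => μ {x | j ∈ visited L e r (L * e + r) t z x}
    with hq₂
  have hm₁ : ∀ j, Measurable (q₁ j) := fun j =>
    measurable_measure_prodMk_right (μ := μ) (hs.measurableSet_mem_visited (L / 8) t j)
  have hm₂ : ∀ j, Measurable (q₂ j) := fun j =>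
    measurable_measure_prodMk_right (μ := μ) (hs.measurableSet_mem_visited (L * e + r) t j)
  have hpt : ∀ p : Phase × Phase, F p.1 * F p.2 * meetingProb hs t μ p.1 p.2 ≤
      F p.1 * (F p.2 - K) + ∑' j, (F p.1 * q₁ j p.1) * (K * q₂ j p.2) := by
    intro p
    have h1 : meetingProb hs t μ p.1 p.2 ≤ 1 := prob_le_one
    have h2 : meetingProb hs t μ p.1 p.2 ≤ ∑' j, q₁ j p.1 * q₂ j p.2 := by
      have := prod_exists_mem_le μ (visited L e r (L / 8) t p.1)
        (visited L e r (L * e + r) t p.2)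
      simp only [meetingProb, hs.mem_revealed]
      exact this
    calc F p.1 * F p.2 * meetingProb hs t μ p.1 p.2
        ≤ F p.1 * ((F p.2 - K) + K) * meetingProb hs t μ p.1 p.2 := by
          gcongr; exact le_tsub_add
      _ = F p.1 * (F p.2 - K) * meetingProb hs t μ p.1 p.2 +
          F p.1 * K * meetingProb hs t μ p.1 p.2 := by ring
      _ ≤ F p.1 * (F p.2 - K) * 1 + F p.1 * K * ∑' j, q₁ j p.1 * q₂ j p.2 := by gcongr
      _ = _ := by
          rw [mul_one, ← ENNReal.tsum_mul_left]
          congr 1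
          exact tsum_congr fun j => by ring
  have hFK : AEMeasurable (fun z => F z - K) phaseVolume := hF.sub aemeasurable_const
  have hprod : AEMeasurable (fun p : Phase × Phase => F p.1 * (F p.2 - K))
      (phaseVolume.prod phaseVolume) :=
    (hF.comp_quasiMeasurePreserving Measure.quasiMeasurePreserving_fst).mul
      (hFK.comp_quasiMeasurePreserving Measure.quasiMeasurePreserving_snd)
  have hF₁ : ∀ j, AEMeasurable (fun z => F z * q₁ j z) phaseVolume := fun j =>
    hF.mul (hm₁ j).aemeasurable
  have hF₂ : ∀ j, AEMeasurable (fun z => K * q₂ j z) phaseVolume := fun j =>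
    ((hm₂ j).const_mul K).aemeasurable
  calc ∫⁻ p, F p.1 * F p.2 * meetingProb hs t μ p.1 p.2 ∂(phaseVolume.prod phaseVolume)
      ≤ ∫⁻ p, F p.1 * (F p.2 - K) + ∑' j, (F p.1 * q₁ j p.1) * (K * q₂ j p.2)
          ∂(phaseVolume.prod phaseVolume) := lintegral_mono hpt
    _ = (∫⁻ z, (F z - K) ∂phaseVolume) + ∑' j, (∫⁻ z, F z * q₁ j z ∂phaseVolume) *
          ∫⁻ z, K * q₂ j z ∂phaseVolume := by
        rw [lintegral_add_left' hprod, lintegral_prod_mul hF hFK, hF1, one_mul, lintegral_tsum]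
        · congr 1
          exact tsum_congr fun j => lintegral_prod_mul (hF₁ j) (hF₂ j)
        · exact fun j =>
            ((hF₁ j).comp_quasiMeasurePreserving Measure.quasiMeasurePreserving_fst).mul
              ((hF₂ j).comp_quasiMeasurePreserving Measure.quasiMeasurePreserving_snd)
    _ ≤ (∫⁻ z, (F z - K) ∂phaseVolume) + K * meetingBound L e r t := by
        gcongr
        set η : ℝ≥0∞ := (⌊t / (L * e + r)⌋₊ + 1 : ℕ) * (2 * (ENNReal.ofReal
          ((L * e + r + (L * e + r)) ^ 2) * SmallScale.unitVolume)) with hη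
        calc ∑' j, (∫⁻ z, F z * q₁ j z ∂phaseVolume) * ∫⁻ z, K * q₂ j z ∂phaseVolume
            ≤ ∑' j, (∫⁻ z, F z * q₁ j z ∂phaseVolume) * (K * η) := by
              gcongr with j
              rw [lintegral_const_mul _ (hm₂ j)]
              gcongr
              exact hs.lintegral_measure_mem_visited_le hδ t μ j
          _ = (∫⁻ z, F z * ∑' j, q₁ j z ∂phaseVolume) * (K * η) := by
              rw [ENNReal.tsum_mul_right, ← lintegral_tsum hF₁]
              simp only [ENNReal.tsum_mul_left]
          _ ≤ (∫⁻ z, F z * (⌊t / (L / 8)⌋₊ + 1 : ℕ) ∂phaseVolume) * (K * η) := by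
              gcongr with z
              exact hs.tsum_measure_mem_visited_le μ t z
          _ = K * meetingBound L e r t := by
              rw [lintegral_mul_const' _ _ (ENNReal.natCast_ne_top _), hF1, one_mul,
                meetingBound, ← hη]
              ring

lemma meetingBound_le (hs : SmallScale L e r) {t : ℝ} (ht : 0 ≤ t) :
    meetingBound L e r t ≤ ENNReal.ofReal
      (8 * (8 * t + L) * (t + (L * e + r)) * ((L * e + r) / L)) * SmallScale.unitVolume := by
  have hδ := hs.reach_pos
  have hL := hs.spacing_pos
  set δ := L * e + r
  have hfloor : ∀ u : ℝ, 0 ≤ u → ((⌊u⌋₊ + 1 : ℕ) : ℝ≥0∞) ≤ ENNReal.ofReal (u + 1) := by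
    intro u hu
    rw [← ENNReal.ofReal_natCast]
    refine ENNReal.ofReal_le_ofReal ?_
    push_cast
    linarith [Nat.floor_le hu]
  have h1 := hfloor (t / (L / 8)) (by positivity)
  have h2 := hfloor (t / δ) (by positivity)
  calc meetingBound L e r t
      ≤ ENNReal.ofReal (t / (L / 8) + 1) * (ENNReal.ofReal (t / δ + 1) *
        (ENNReal.ofReal 2 * (ENNReal.ofReal ((δ + δ) ^ 2) * SmallScale.unitVolume))) := by
        rw [meetingBound, ENNReal.ofReal_ofNat]
        gcongr
    _ = ENNReal.ofReal ((t / (L / 8) + 1) * ((t / δ + 1) * (2 * (δ + δ) ^ 2))) *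
          SmallScale.unitVolume := by
        rw [ENNReal.ofReal_mul (by positivity), ENNReal.ofReal_mul (by positivity),
          ENNReal.ofReal_mul (by positivity)]
        ring
    _ = _ := by
        congr 2
        field_simp
        ring

end Meeting

/-! ### The limit of small obstacles -/

lemma tendsto_rpow_zero {s : ℝ} (hs : 0 < s) :
    Tendsto (fun ε : ℝ => ε ^ s) (𝓝[>] 0) (𝓝 0) := by
  have := (Real.continuousAt_rpow_const 0 s (Or.inr hs.le)).tendsto
  rw [Real.zero_rpow hs.ne'] at this
  exact this.mono_left nhdsWithin_le_nhds

lemma tendsto_sqrt_zero : Tendsto (fun ε : ℝ => √ε) (𝓝[>] 0) (𝓝 0) := by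
  have := Real.continuous_sqrt.tendsto 0
  rw [Real.sqrt_zero] at this
  exact this.mono_left nhdsWithin_le_nhds

lemma eventually_smallScale {ν : ℝ} (hν : ν < 1) :
    ∀ᶠ ε in 𝓝[>] (0 : ℝ), SmallScale (√ε) (ε ^ (1 - ν)) ε := by
  have h1 := tendsto_rpow_zero (sub_pos.2 hν)
  have h2 := tendsto_sqrt_zero
  filter_upwards [h1.eventually (ge_mem_nhds (by norm_num : (0 : ℝ) < 1 / 8)),
    h2.eventually (ge_mem_nhds (by norm_num : (0 : ℝ) < 1 / 16)), self_mem_nhdsWithin]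
    with ε he hL (hε : 0 < ε)
  refine ⟨Real.sqrt_pos.2 hε, (Real.rpow_pos_of_pos hε _).le, hε, he, ?_⟩
  nlinarith [Real.mul_self_sqrt hε.le, Real.sqrt_nonneg ε]

lemma tendsto_meetingBound {ν : ℝ} (hν : ν < 1) {t : ℝ} (ht : 0 ≤ t) :
    Tendsto (fun ε : ℝ => meetingBound (√ε) (ε ^ (1 - ν)) ε t) (𝓝[>] 0) (𝓝 0) := by
  have h1 := tendsto_rpow_zero (sub_pos.2 hν)
  have h2 := tendsto_sqrt_zero
  have h3 : Tendsto (fun ε : ℝ => ε) (𝓝[>] 0) (𝓝 0) := tendsto_id.mono_left nhdsWithin_le_nhds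
  have h4 : Tendsto (fun ε : ℝ => 8 * (8 * t + √ε) * (t + (√ε * ε ^ (1 - ν) + ε)) *
      (ε ^ (1 - ν) + √ε)) (𝓝[>] 0) (𝓝 0) := by
    have := (((h2.const_add (8 * t)).const_mul 8).mul
      (((h2.mul h1).add h3).const_add t)).mul (h1.add h2)
    simpa using this
  have h5 := ENNReal.Tendsto.mul_const (b := SmallScale.unitVolume)
    (ENNReal.tendsto_ofReal h4) (Or.inr SmallScale.unitVolume_ne_top)
  rw [ENNReal.ofReal_zero, zero_mul] at h5
  refine tendsto_of_tendsto_of_tendsto_of_le_of_le' tendsto_const_nhds h5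
    (Eventually.of_forall fun _ => zero_le) ?_
  filter_upwards [eventually_smallScale hν, self_mem_nhdsWithin] with ε hs (hε : 0 < ε)
  refine (meetingBound_le hs ht).trans_eq ?_
  have hL := Real.sqrt_pos.2 hε
  congr 3
  field_simp
  linear_combination -(Real.mul_self_sqrt hε.le)

lemma tendsto_lintegral_sub {α : Type*} [MeasurableSpace α] {m : Measure α} {F : α → ℝ≥0∞}
    (hF : AEMeasurable F m) (hfin : ∫⁻ a, F a ∂m ≠ ∞) :
    Tendsto (fun K : ℕ => ∫⁻ a, (F a - K) ∂m) atTop (𝓝 0) := by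
  have := tendsto_lintegral_of_dominated_convergence' (μ := m) (f := fun _ => 0)
    (F := fun (K : ℕ) a => F a - K) F (fun K => hF.sub aemeasurable_const)
    (fun K => ae_of_all _ fun a => tsub_le_self) hfin ?_
  · simpa using this
  · filter_upwards [ae_lt_top' hF hfin] with a ha
    obtain ⟨N, hN⟩ := ENNReal.exists_nat_gt ha.ne
    refine tendsto_const_nhds.congr' ?_
    filter_upwards [eventually_ge_atTop N] with K hK
    rw [tsub_eq_zero_of_le (hN.le.trans (by exact_mod_cast hK))]

section

variable {Ω : Type*} {ξ : ℤ × ℤ → Ω → Plane}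

lemma ae_norm_lt_one [MeasurableSpace Ω] {P : Measure Ω} {φ : Plane → ℝ}
    (hφ_supp : ∀ x, 1 ≤ ‖x‖ → φ x = 0) (hξ : IsIIDWithDensity P φ ξ) :
    ∀ᵐ ω ∂P, ∀ j, ‖ξ j ω‖ < 1 := by
  rw [ae_all_iff]
  intro j
  have hm : MeasurableSet {x : Plane | 1 ≤ ‖x‖} := measurableSet_le measurable_const measurable_norm
  have h : P.map (ξ j) {x | 1 ≤ ‖x‖} = 0 := by
    rw [hξ.law j, withDensity_apply _ hm, setLIntegral_congr_fun (g := fun _ => 0) hm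
      fun x hx => by simp only [hφ_supp x hx, ENNReal.ofReal_zero]]
    simp
  rw [Measure.map_apply (hξ.measurable j) hm] at h
  rw [ae_iff]
  simpa using h

lemma lorentzProcess_eq {ν ε : ℝ} {ω : Ω} (h : ∀ j, ‖ξ j ω‖ < 1) (t : ℝ) (z : Phase) :
    lorentzProcess ν ξ ε t ω z = latticeFlow (√ε) (ε ^ (1 - ν)) ε (fun j => ξ j ω) t z := by
  rw [lorentzProcess, latticeFlow]
  congr 1
  rw [obstacleCenters, perturbedLattice, ← Set.range_comp]
  congr 1
  ext1 j
  simp [center, clip, h j]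

end

lemma exists_bound {M : ℝ} {g : Phase → ℝ} (hg : Continuous g)
    (hsupp : Function.support g ⊆ Metric.closedBall 0 M ×ˢ Set.univ) : ∃ G, ∀ z, ‖g z‖ ≤ G := by
  obtain ⟨C, hC⟩ := ((isCompact_closedBall (0 : Plane) M).prod
    (isCompact_univ (X := UnitCircle))).exists_bound_of_continuousOn hg.continuousOn
  refine ⟨max C 0, fun z => ?_⟩
  by_cases hz : g z = 0
  · simp [hz]
  · exact (hC z (hsupp hz)).trans (le_max_left _ _)

/-- The covariance of observables of two particles is controlled by the probability that their
trajectories visit a common site. -/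
lemma enorm_covariance_latticeFlow_le {L e r : ℝ} (hs : SmallScale L e r) {μ : Measure Config}
    [IsProbabilityMeasure μ] (hμ : ResamplingInvariant μ) {t : ℝ} (ht : 0 ≤ t)
    {g₁ g₂ : Phase → ℝ} (hg₁ : Measurable g₁) (hg₂ : Measurable g₂) {G₁ G₂ : ℝ}
    (hG₁ : ∀ z, ‖g₁ z‖ ≤ G₁) (hG₂ : ∀ z, ‖g₂ z‖ ≤ G₂) (z z' : Phase) :
    ‖(∫ x, g₁ (latticeFlow L e r x t z) * g₂ (latticeFlow L e r x t z') ∂μ) -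
        (∫ x, g₁ (latticeFlow L e r x t z) ∂μ) * ∫ x, g₂ (latticeFlow L e r x t z') ∂μ‖ₑ ≤
      ENNReal.ofReal (2 * G₁ * G₂) * meetingProb hs t μ z z' := by
  have hm : ∀ w, Measurable fun x : Config => latticeFlow L e r x t w := fun w =>
    hs.measurable_latticeFlow t measurable_id measurable_const
  have hL : 0 < L / 8 := by have := hs.spacing_pos; positivity
  refine hμ.enorm_covariance_le (hs.isStoppingSet_revealed t z)
    (V := visited L e r (L * e + r) t z')
    (F₁ := fun x => g₁ (latticeFlow L e r x t z)) (F₂ := fun x => g₂ (latticeFlow L e r x t z'))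
    (hg₁.comp (hm z)) (hg₂.comp (hm z')) (fun _ => hG₁ _) (fun _ => hG₂ _) ?_ ?_
  · intro x y hxy
    simp only [hs.latticeFlow_congr hL (fun j hj => hxy j (hs.mem_revealed.2 hj)) ht le_rfl]
  · intro x y hxy
    simp only [hs.latticeFlow_congr hs.reach_pos hxy ht le_rfl]

end

end LorentzGas

theorem theorem3
    {Ω : Type*} [MeasurableSpace Ω] (P : Measure Ω) [IsProbabilityMeasure P]
    (φ : LorentzGas.Plane → ℝ)
    (hφ : LorentzGas.IsProbDensity (volume : Measure LorentzGas.Plane) φ)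
    (hφ_radial : ∀ x y, ‖x‖ = ‖y‖ → φ x = φ y)
    (hφ_supp : ∀ x, 1 ≤ ‖x‖ → φ x = 0)
    (ξ : ℤ × ℤ → Ω → LorentzGas.Plane)
    (hξ : LorentzGas.IsIIDWithDensity P φ ξ)
    (ν : ℝ) (hν : ν ∈ Set.Ioo (1 / 2 : ℝ) 1)
    (f₀ : LorentzGas.Phase → ℝ)
    (hf₀ : LorentzGas.IsProbDensity LorentzGas.phaseVolume f₀)
    (tbar : ℝ) (htbar : 0 < tbar) (t : ℝ) (ht : t ∈ Set.Icc 0 tbar)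
    (M : ℝ) (hM : 0 < M) (g₁ g₂ : LorentzGas.Phase → ℝ)
    (hg₁ : Continuous g₁) (hg₂ : Continuous g₂)
    (hg₁_supp : Function.support g₁ ⊆ Metric.closedBall 0 M ×ˢ Set.univ)
    (hg₂_supp : Function.support g₂ ⊆ Metric.closedBall 0 M ×ˢ Set.univ) :
    (∀ᶠ ε in 𝓝[>] (0 : ℝ),
      (∀ z, AEMeasurable (fun ω => LorentzGas.lorentzProcess ν ξ ε t ω z) P) ∧
      AEMeasurable (fun q : Ω × LorentzGas.Phase => LorentzGas.lorentzProcess ν ξ ε t q.1 q.2)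
        (P.prod LorentzGas.phaseVolume)) ∧
    Tendsto
      (fun ε : ℝ =>
        ∫ p : LorentzGas.Phase × LorentzGas.Phase,
          f₀ p.1 * f₀ p.2 *
            ((∫ ω, LorentzGas.tensor g₁ g₂ (LorentzGas.lorentzPairProcess ν ξ ε t ω p) ∂P) -
              (∫ ω, g₁ (LorentzGas.lorentzProcess ν ξ ε t ω p.1) ∂P) *
                (∫ ω, g₂ (LorentzGas.lorentzProcess ν ξ ε t ω p.2) ∂P))
          ∂(LorentzGas.phaseVolume.prod LorentzGas.phaseVolume))
      (𝓝[>] 0) (𝓝 0) := by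
  open LorentzGas in
  have hae := ae_norm_lt_one hφ_supp hξ
  have hX : Measurable fun ω j => ξ j ω := measurable_pi_iff.2 hξ.measurable
  refine ⟨?_, ?_⟩
  · filter_upwards [eventually_smallScale hν.2] with ε hs
    refine ⟨fun z => ?_, ?_⟩
    · refine ⟨fun ω => latticeFlow (√ε) (ε ^ (1 - ν)) ε (fun j => ξ j ω) t z,
        hs.measurable_latticeFlow t hX measurable_const, ?_⟩
      filter_upwards [hae] with ω hω
      exact lorentzProcess_eq hω t z
    · refine ⟨fun q => latticeFlow (√ε) (ε ^ (1 - ν)) ε (fun j => ξ j q.1) t q.2,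
        hs.measurable_latticeFlow t (hX.comp measurable_fst) measurable_snd, ?_⟩
      filter_upwards [Measure.quasiMeasurePreserving_fst.ae hae] with q hq
      exact lorentzProcess_eq hq t q.2
  · obtain ⟨G₁, hG₁⟩ := exists_bound hg₁ hg₁_supp
    obtain ⟨G₂, hG₂⟩ := exists_bound hg₂ hg₂_supp
    set μ : Measure Config := P.map fun ω j => ξ j ω with hμdef
    have : IsProbabilityMeasure μ := Measure.isProbabilityMeasure_map hX.aemeasurable
    have hμ : ResamplingInvariant μ := resamplingInvariant_map hξ.measurable hξ.indep
    set F : Phase → ℝ≥0∞ := fun z => ENNReal.ofReal (f₀ z) with hFdef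
    have hF : AEMeasurable F phaseVolume := hf₀.integrable.aemeasurable.ennreal_ofReal
    have hF1 : ∫⁻ z, F z ∂phaseVolume = 1 := by
      rw [← ofReal_integral_eq_lintegral_ofReal hf₀.integrable (ae_of_all _ hf₀.nonneg),
        hf₀.integral_eq_one, ENNReal.ofReal_one]
    set C := ENNReal.ofReal (2 * G₁ * G₂)
    rw [tendsto_zero_iff_enorm_tendsto_zero]
    -- The bound for a fixed truncation level `K` of the initial density.
    have hbound : ∀ᶠ ε in 𝓝[>] (0 : ℝ), ∀ K : ℕ,
        ‖∫ p : Phase × Phase, f₀ p.1 * f₀ p.2 *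
            ((∫ ω, tensor g₁ g₂ (lorentzPairProcess ν ξ ε t ω p) ∂P) -
              (∫ ω, g₁ (lorentzProcess ν ξ ε t ω p.1) ∂P) *
                (∫ ω, g₂ (lorentzProcess ν ξ ε t ω p.2) ∂P))
          ∂(phaseVolume.prod phaseVolume)‖ₑ ≤
        C * ((∫⁻ z, (F z - K) ∂phaseVolume) + K * meetingBound (√ε) (ε ^ (1 - ν)) ε t) := by
      filter_upwards [eventually_smallScale hν.2] with ε hs K
      have hm : ∀ w, Measurable fun x : Config => latticeFlow (√ε) (ε ^ (1 - ν)) ε x t w :=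
        fun w => hs.measurable_latticeFlow t measurable_id measurable_const
      have hmap : ∀ k : Config → ℝ, Measurable k →
          ∫ x, k x ∂μ = ∫ ω, k (fun j => ξ j ω) ∂P := fun k hk =>
        integral_map hX.aemeasurable hk.aestronglyMeasurable
      refine (enorm_integral_le_lintegral_enorm _).trans ?_
      refine le_trans ?_ (mul_le_mul_right (lintegral_meetingProb_le hs t μ hF hF1 K) C)
      rw [← lintegral_const_mul' _ _ ENNReal.ofReal_ne_top]
      refine lintegral_mono fun p => ?_
      have h12 : ∫ ω, tensor g₁ g₂ (lorentzPairProcess ν ξ ε t ω p) ∂P =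
          ∫ x, g₁ (latticeFlow (√ε) (ε ^ (1 - ν)) ε x t p.1) *
            g₂ (latticeFlow (√ε) (ε ^ (1 - ν)) ε x t p.2) ∂μ := by
        rw [hmap (fun x => g₁ (latticeFlow (√ε) (ε ^ (1 - ν)) ε x t p.1) *
          g₂ (latticeFlow (√ε) (ε ^ (1 - ν)) ε x t p.2))
          ((hg₁.measurable.comp (hm p.1)).mul (hg₂.measurable.comp (hm p.2)))]
        refine integral_congr_ae ?_
        filter_upwards [hae] with ω hω
        rw [← lorentzProcess_eq hω, ← lorentzProcess_eq hω]
        rfl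
      have h1 : ∀ (g : Phase → ℝ), Continuous g → ∀ w,
          ∫ ω, g (lorentzProcess ν ξ ε t ω w) ∂P =
            ∫ x, g (latticeFlow (√ε) (ε ^ (1 - ν)) ε x t w) ∂μ := by
        intro g hg w
        rw [hmap (fun x => g (latticeFlow (√ε) (ε ^ (1 - ν)) ε x t w))
          (hg.measurable.comp (hm w))]
        refine integral_congr_ae ?_
        filter_upwards [hae] with ω hω
        rw [← lorentzProcess_eq hω]
      have hcov := enorm_covariance_latticeFlow_le hs hμ ht.1 hg₁.measurable hg₂.measurable
        hG₁ hG₂ p.1 p.2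
      rw [h12, h1 g₁ hg₁, h1 g₂ hg₂, enorm_mul, enorm_mul, Real.enorm_of_nonneg (hf₀.nonneg _),
        Real.enorm_of_nonneg (hf₀.nonneg _)]
      calc _ ≤ F p.1 * F p.2 * (C * meetingProb hs t μ p.1 p.2) := mul_le_mul_right hcov _
        _ = _ := by ring
    rw [ENNReal.tendsto_nhds_zero]
    intro η hη
    have hη2 : 0 < η / 2 := ENNReal.half_pos hη.ne'
    have htail := ENNReal.Tendsto.const_mul (a := C)
      (tendsto_lintegral_sub hF (by rw [hF1]; exact ENNReal.one_ne_top))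
      (Or.inr ENNReal.ofReal_ne_top)
    rw [mul_zero] at htail
    obtain ⟨K, hK⟩ := (ENNReal.tendsto_nhds_zero.1 htail (η / 2) hη2).exists
    have hmeet := ENNReal.Tendsto.const_mul (a := C * K) (tendsto_meetingBound hν.2 ht.1)
      (Or.inr (ENNReal.mul_ne_top ENNReal.ofReal_ne_top (ENNReal.natCast_ne_top K)))
    rw [mul_zero] at hmeet
    filter_upwards [hbound, ENNReal.tendsto_nhds_zero.1 hmeet (η / 2) hη2] with ε h1 h2
    calc _ ≤ _ := h1 K
      _ = C * (∫⁻ z, (F z - K) ∂phaseVolume) +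
          C * K * meetingBound (√ε) (ε ^ (1 - ν)) ε t := by ring
      _ ≤ η / 2 + η / 2 := add_le_add hK h2
      _ = η := ENNReal.add_halves η
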